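/- Let $S^{d-1}$ denote the unit sphere in $\mathbb{R}^d$ with its surface measure $\sigma$. A spherical $t$-design is a non-empty finite set $X\subset S^{d-1}$ such that $$\frac{1}{|X|}\sum_{x\in X} f(x)=\frac{1}{\sigma(S^{d-1})}\int_{S^{d-1}} f\,d\sigma$$ for every real polynomial $f$ in $d$ variables of total degree at most $t$. For an integer $m\ge 1$, an $m$-stiff configuration in $S^{d-1}$ is a spherical $(2m-1)$-design $X\subset S^{d-1}$ for which there is a point $z\in S^{d-1}$ such that the set of inner products $\{\langle z,x\rangle : x\in X\}$ has at most $m$ elements. Theorem. Let $d$ be an even integer with $8\le d\le 120$, and let $n\ge 1$ be an integer. Then there exists a $2n$-stiff configuration in $S^{d-1}$ if and only if $n=1$. -/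

import Mathlib

/-- The unit sphere `S^{d-1}` in Euclidean space `ℝ^d`. -/
abbrev UnitSphere (d : ℕ) : Type :=
  Metric.sphere (0 : EuclideanSpace ℝ (Fin d)) 1

/-- The surface measure on `S^{d-1}`, i.e. the spherical measure induced by Lebesgue measure. -/
noncomputable def surfaceMeasure (d : ℕ) : MeasureTheory.Measure (UnitSphere d) :=
  (MeasureTheory.volume : MeasureTheory.Measure (EuclideanSpace ℝ (Fin d))).toSphere

/-- A spherical `t`-design: a non-empty finite `X ⊆ S^{d-1}` such that every real polynomial in
`d` variables of total degree at most `t` has the same average over `X` and over the sphere. -/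
def IsSphericalDesign {d : ℕ} (t : ℕ) (X : Finset (UnitSphere d)) : Prop :=
  X.Nonempty ∧
    ∀ f : MvPolynomial (Fin d) ℝ, f.totalDegree ≤ t →
      (1 / (X.card : ℝ)) * ∑ x ∈ X, MvPolynomial.eval (fun i => x.1 i) f =
        (1 / (surfaceMeasure d).real Set.univ) *
          ∫ x, MvPolynomial.eval (fun i => x.1 i) f ∂(surfaceMeasure d)

/-- The set `D(z, X)` of inner products of `z` with the points of `X`. -/
def innerProducts {d : ℕ} (z : UnitSphere d) (X : Finset (UnitSphere d)) : Set ℝ :=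
  {s : ℝ | ∃ x ∈ X, s = inner ℝ z.1 x.1}

/-- `X` is `m`-stiff (`m ≥ 1`): it is a spherical `(2m-1)`-design, and some point `z` of the sphere
has at most `m` distinct inner products with the points of `X`
(equivalently, `X` lies on at most `m` parallel hyperplanes orthogonal to `z`). -/
def IsStiff {d : ℕ} (m : ℕ) (X : Finset (UnitSphere d)) : Prop :=
  1 ≤ m ∧ IsSphericalDesign (2 * m - 1) X ∧
    {z : UnitSphere d | (innerProducts z X).ncard ≤ m}.Nonempty

/-!
Write `d = 2 * l + 2`. For `n = 1` the cross-polytope `{± e_i}` with `z = (1, ..., 1) / √d` is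
2-stiff (`exists_two_stiff`).

Let `n ≥ 2` and let `X` be a `2n`-stiff configuration. Counting the points of `X` on each hyperplane
orthogonal to `z` gives a quadrature formula with *rational* weights and at most `2n` nodes, exact in
degree `4n - 1` for the weight `(1 - x ^ 2) ^ ((d - 3) / 2)`. All that is needed of this weight is
its Pearson equation (`momentFunctional_pearson`): it yields that there are exactly `2n` nodes, that
the node polynomial `N` satisfies the Gegenbauer differential equation, and that the weight at a node
`t` is a constant multiple of `1 / ((1 - t ^ 2) * N'(t) ^ 2)` (`card_nodes_eq`, `gegenbauerOp_nodal`,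
`weight_mul_eq`). By the differential equation `N` is proportional to `A(x ^ 2)`, where
`A = ₂F₁(-n, n + l; 1/2; y)` has rational coefficients. So rationality of the weights means that
`y (1 - y) A'(y) ^ 2` is a rational number at every root `y` of `A`. This is an algebraic
property (`RationalAtRoots`), hence it can be tested in an algebraic closure of `ℚ_p` for any `p`; it
can also be tested after the substitution `y ↦ 1 - y`, which turns `A` into a multiple of
`₂F₁(-n, n + l; l + 1/2; y)`.

If the first edge of the `p`-adic Newton polygon of one of these two polynomials has slope `-1 / e`
with `e ≥ 2` prime to `p`, then `y (1 - y) A'(y) ^ 2` has valuation `-1 / e` at the corresponding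
roots `y`, so it is not rational (`exists_root_not_rational_of_norm`). From the explicit coefficients
this happens whenever a prime `p ≥ 2 * l + 3` divides one of the `2 * l - 1` consecutive numbers
`2 * n + 1, ..., 2 * n + 2 * l - 1` (`not_rationalAtRoots_of_prime_dvd`).

If there is no such prime, comparing the binomial coefficient `(2n + 2l - 1).choose (2l - 1)` with its
prime factorization bounds `n` (`lt_of_smooth`). For `l ≤ 59` this leaves, besides `n = 2`, a short
list of pairs, for which a smaller prime does the same job. For `n = 2` rationality would make the
roots of the quadratic `A` rational, and its discriminant is never a square
(`not_rationalAtRoots_two`).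
-/

/-! ### Moments of the sphere -/

instance {d : ℕ} : MeasureTheory.IsFiniteMeasure (surfaceMeasure d) := by
  unfold surfaceMeasure; infer_instance

open MeasureTheory Set in
/-- Integration of a homogeneous function against a Gaussian in polar coordinates: the integral
splits into a spherical factor and a Gamma factor. -/
theorem integral_homogeneous_mul_gaussian {d : ℕ} (hd : 1 ≤ d) (k : ℕ)
    (f : EuclideanSpace ℝ (Fin d) → ℝ)
    (hf : ∀ r : ℝ, 0 < r → ∀ x, f (r • x) = r ^ k * f x) :
    ∫ x, f x * Real.exp (-‖x‖ ^ 2) =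
      (∫ x, f x.1 ∂(surfaceMeasure d)) * (Real.Gamma ((k + d) / 2) / 2) := by
  have : Nontrivial (EuclideanSpace ℝ (Fin d)) := by
    have : Nonempty (Fin d) := ⟨⟨0, hd⟩⟩
    infer_instance
  have hdim : Module.finrank ℝ (EuclideanSpace ℝ (Fin d)) = d := by simp
  have hmp :=
    (volume : Measure (EuclideanSpace ℝ (Fin d))).measurePreserving_homeomorphUnitSphereProd
  calc
    ∫ x, f x * Real.exp (-‖x‖ ^ 2)
      = ∫ x : ({(0)}ᶜ : Set (EuclideanSpace ℝ (Fin d))), f x.1 * Real.exp (-‖x.1‖ ^ 2)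
          ∂(volume.comap Subtype.val) := by
      rw [integral_subtype_comap (measurableSet_singleton _).compl
        fun x ↦ f x * Real.exp (-‖x‖ ^ 2), restrict_compl_singleton]
    _ = ∫ x, f x.1.1 * (x.2.1 ^ k * Real.exp (-x.2.1 ^ 2))
          ∂(surfaceMeasure d).prod (.volumeIoiPow (d - 1)) := by
      have := hmp.integral_comp (Homeomorph.measurableEmbedding _)
        (fun x => f x.1.1 * (x.2.1 ^ k * Real.exp (-x.2.1 ^ 2)))
      rw [hdim] at this
      rw [surfaceMeasure, ← this]
      refine integral_congr_ae (.of_forall fun x => ?_)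
      have hx : 0 < ‖x.1‖ := norm_pos_iff.2 x.2
      have h1 := hf ‖x.1‖ hx (‖x.1‖⁻¹ • x.1)
      rw [smul_smul, mul_inv_cancel₀ hx.ne', one_smul] at h1
      simp only [homeomorphUnitSphereProd_apply_snd_coe, homeomorphUnitSphereProd_apply_fst_coe]
      rw [h1]
      ring
    _ = (∫ x, f x.1 ∂(surfaceMeasure d)) *
          ∫ x : Ioi (0 : ℝ), x.1 ^ k * Real.exp (-x.1 ^ 2) ∂(.volumeIoiPow (d - 1)) :=
      integral_prod_mul (fun x : UnitSphere d => f x.1)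
        (fun x : Ioi (0 : ℝ) => x.1 ^ k * Real.exp (-x.1 ^ 2))
    _ = _ := by
      congr 1
      simp only [Measure.volumeIoiPow, ENNReal.ofReal]
      rw [integral_withDensity_eq_integral_smul,
        integral_subtype_comap measurableSet_Ioi fun a ↦
          Real.toNNReal (a ^ (d - 1)) • (a ^ k * Real.exp (-a ^ 2))]
      · have h := _root_.integral_rpow_mul_exp_neg_rpow (p := 2) (q := ((k + d : ℕ) : ℝ) - 1)
          (by norm_num) (by have : (0 : ℝ) < ((k + d : ℕ) : ℝ) := by positivity
                            linarith)
        have e : ((((k + d : ℕ) : ℝ) - 1) + 1) / 2 = (k + d) / 2 := by push_cast; ring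
        rw [e] at h
        have : Real.Gamma ((k + d) / 2) / 2 = 1 / 2 * Real.Gamma ((k + d) / 2) := by ring
        rw [this, ← h]
        refine setIntegral_congr_fun measurableSet_Ioi fun x hx ↦ ?_
        have hx' : (0 : ℝ) < x := hx
        simp only [NNReal.smul_def, Real.coe_toNNReal _ (pow_nonneg hx'.le _), smul_eq_mul]
        rw [← mul_assoc, ← pow_add, ← Real.rpow_natCast x 2, ← Real.rpow_natCast]
        congr 2
        rw [Nat.cast_add, Nat.cast_sub hd]
        push_cast
        ring
      · exact (measurable_subtype_coe.pow_const _).real_toNNReal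

/-- The moments `∫ x ^ a * exp (-x ^ 2)` of the one-dimensional Gaussian. -/
noncomputable def gaussianMoment (a : ℕ) : ℝ := ∫ x : ℝ, x ^ a * Real.exp (-x ^ 2)

theorem gaussianMoment_odd {a : ℕ} (ha : Odd a) : gaussianMoment a = 0 := by
  have h := MeasureTheory.integral_neg_eq_self (fun x : ℝ => x ^ a * Real.exp (-x ^ 2))
    MeasureTheory.volume
  simp only [ha.neg_pow, even_two.neg_pow, neg_mul, MeasureTheory.integral_neg] at h
  unfold gaussianMoment
  linarith

theorem gaussianMoment_even {a : ℕ} (ha : Even a) :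
    gaussianMoment a = Real.Gamma ((a + 1) / 2) := by
  have h1 := integral_comp_abs (f := fun x : ℝ => x ^ a * Real.exp (-x ^ 2))
  simp only [ha.pow_abs, sq_abs] at h1
  have h := _root_.integral_rpow_mul_exp_neg_rpow (p := 2) (q := (a : ℝ)) (by norm_num)
    (by have : (0 : ℝ) ≤ (a : ℝ) := by positivity
        linarith)
  unfold gaussianMoment
  rw [h1]
  have h2 : Real.Gamma ((a + 1) / 2) = 2 * (1 / 2 * Real.Gamma ((a + 1) / 2)) := by ring
  rw [h2, ← h]
  congr 1
  refine MeasureTheory.setIntegral_congr_fun measurableSet_Ioi fun x _ ↦ ?_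
  rw [← Real.rpow_natCast x 2, ← Real.rpow_natCast]
  norm_num

theorem gaussianMoment_add_two (a : ℕ) :
    gaussianMoment (a + 2) = (a + 1) / 2 * gaussianMoment a := by
  rcases Nat.even_or_odd a with ha | ha
  · rw [gaussianMoment_even ha, gaussianMoment_even (ha.add even_two),
      ← Real.Gamma_add_one (by positivity)]
    congr 1
    push_cast
    ring
  · rw [gaussianMoment_odd ha, gaussianMoment_odd (ha.add_even even_two), mul_zero]

/-- Monomials on the sphere, in terms of one-dimensional Gaussian moments. -/
theorem integral_sphere_monomial {d : ℕ} (hd : 1 ≤ d) (α : Fin d → ℕ) :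
    (∫ x, ∏ i, x.1 i ^ α i ∂(surfaceMeasure d)) *
      (Real.Gamma (((∑ i, α i : ℕ) + d) / 2) / 2) = ∏ i, gaussianMoment (α i) := by
  rw [← integral_homogeneous_mul_gaussian hd (∑ i, α i)
    (fun x : EuclideanSpace ℝ (Fin d) => ∏ i, x i ^ α i)]
  · have h := (EuclideanSpace.volume_preserving_symm_measurableEquiv_toLp
      (Fin d)).symm.integral_comp'
      (fun x : EuclideanSpace ℝ (Fin d) => (∏ i, x i ^ α i) * Real.exp (-‖x‖ ^ 2))
    rw [← h]
    unfold gaussianMoment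
    rw [← MeasureTheory.integral_fintype_prod_volume_eq_prod]
    refine MeasureTheory.integral_congr_ae (.of_forall fun x => ?_)
    simp only [Finset.prod_mul_distrib, ← Real.exp_sum, EuclideanSpace.norm_sq_eq]
    simp
  · intro r _ x
    simp [mul_pow, Finset.prod_mul_distrib, Finset.prod_pow_eq_pow_sum]

/-- The spherical moments of a linear functional do not depend on its direction. -/
theorem integral_sphere_inner_pow {d : ℕ} (hd : 1 ≤ d) (z : UnitSphere d) (k : ℕ) :
    (∫ x, (inner ℝ z.1 x.1 : ℝ) ^ k ∂(surfaceMeasure d)) * (Real.Gamma ((k + d) / 2) / 2) =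
      gaussianMoment k * gaussianMoment 0 ^ (d - 1) := by
  let i0 : Fin d := ⟨0, hd⟩
  let e0 : EuclideanSpace ℝ (Fin d) := EuclideanSpace.single i0 1
  have hz : ‖z.1‖ = 1 := by simp
  -- The reflection exchanging `z` with the first basis vector reduces to a single coordinate.
  obtain ⟨U, hU⟩ : ∃ U : EuclideanSpace ℝ (Fin d) ≃ₗᵢ[ℝ] EuclideanSpace ℝ (Fin d), U z.1 = e0 :=
    ⟨_, Submodule.reflection_sub (by rw [hz]; simp [e0])⟩
  rw [← integral_homogeneous_mul_gaussian hd k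
    (fun x : EuclideanSpace ℝ (Fin d) => (inner ℝ z.1 x : ℝ) ^ k)]
  · rw [← U.symm.measurePreserving.integral_comp U.symm.toHomeomorph.measurableEmbedding]
    have h := (EuclideanSpace.volume_preserving_symm_measurableEquiv_toLp
      (Fin d)).symm.integral_comp'
      (fun x : EuclideanSpace ℝ (Fin d) => (inner ℝ z.1 (U.symm x) : ℝ) ^ k *
        Real.exp (-‖U.symm x‖ ^ 2))
    rw [← h]
    have hp : gaussianMoment k * gaussianMoment 0 ^ (d - 1) =
        ∏ i, gaussianMoment (if i = i0 then k else 0) := by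
      rw [← Finset.mul_prod_erase _ _ (Finset.mem_univ i0), if_pos rfl]
      congr 1
      rw [Finset.prod_congr rfl (g := fun _ => gaussianMoment 0)
        (fun i hi => by rw [if_neg (Finset.ne_of_mem_erase hi)])]
      simp
    rw [hp]
    unfold gaussianMoment
    rw [← MeasureTheory.integral_fintype_prod_volume_eq_prod]
    refine MeasureTheory.integral_congr_ae (.of_forall fun x => ?_)
    have hin : ∀ y, (inner ℝ z.1 (U.symm y) : ℝ) = y i0 := by
      intro y
      rw [← U.inner_map_map, hU]
      simp [e0, EuclideanSpace.inner_single_left]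
    simp only [Finset.prod_mul_distrib, ← Real.exp_sum, hin, LinearIsometryEquiv.norm_map,
      EuclideanSpace.norm_sq_eq]
    simp [pow_ite]
  · intro r _ x
    simp [inner_smul_right, mul_pow]

theorem integral_sphere_one_ne_zero {d : ℕ} (hd : 1 ≤ d) : (surfaceMeasure d).real Set.univ ≠ 0 := by
  have h := integral_sphere_monomial hd (fun _ => 0)
  have h0 : 0 < gaussianMoment 0 := by
    rw [gaussianMoment_even Even.zero]
    exact Real.Gamma_pos_of_pos (by norm_num)
  intro h1
  simp [h1] at h
  exact (pow_pos h0 d).ne h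

/-- Recursion for the moments of a coordinate on the sphere `S^{d-1}`. -/
theorem integral_sphere_inner_pow_add_two {d : ℕ} (hd : 1 ≤ d) (z : UnitSphere d) (k : ℕ) :
    (k + d) * ∫ x, (inner ℝ z.1 x.1 : ℝ) ^ (k + 2) ∂(surfaceMeasure d) =
      (k + 1) * ∫ x, (inner ℝ z.1 x.1 : ℝ) ^ k ∂(surfaceMeasure d) := by
  have h1 := integral_sphere_inner_pow hd z (k + 2)
  have h0 := integral_sphere_inner_pow hd z k
  have hpos : (0 : ℝ) < (k + d) / 2 := by positivity
  have hG := Real.Gamma_pos_of_pos hpos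
  have hg : Real.Gamma (((k + 2 : ℕ) + d) / 2) = (k + d) / 2 * Real.Gamma ((k + d) / 2) := by
    rw [← Real.Gamma_add_one hpos.ne']
    congr 1
    push_cast
    ring
  rw [hg, gaussianMoment_add_two, mul_assoc, ← h0] at h1
  have : (Real.Gamma ((k + d) / 2) / 2) * (((k : ℝ) + d) * ∫ x, (inner ℝ z.1 x.1 : ℝ) ^ (k + 2)
      ∂(surfaceMeasure d)) = (Real.Gamma ((k + d) / 2) / 2) * (((k : ℝ) + 1) *
      ∫ x, (inner ℝ z.1 x.1 : ℝ) ^ k ∂(surfaceMeasure d)) := by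
    linear_combination 2 * h1
  exact mul_left_cancel₀ (by positivity) this

theorem integral_sphere_inner {d : ℕ} (hd : 1 ≤ d) (z : UnitSphere d) :
    ∫ x, (inner ℝ z.1 x.1 : ℝ) ∂(surfaceMeasure d) = 0 := by
  have h1 := integral_sphere_inner_pow hd z 1
  rw [gaussianMoment_odd odd_one, zero_mul] at h1
  have hG := Real.Gamma_pos_of_pos (s := ((1 : ℕ) + d) / 2) (by positivity)
  simpa only [pow_one, mul_eq_zero, div_eq_zero_iff, hG.ne', two_ne_zero, or_false] using h1

/-! ### The cross-polytope is a spherical 3-design -/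

/-- The vertices `± e_i` of the cross-polytope. -/
noncomputable def crossVertex (d : ℕ) (q : Fin d × Bool) : UnitSphere d :=
  ⟨EuclideanSpace.single q.1 (if q.2 then 1 else -1), by rcases q with ⟨i, _ | _⟩ <;> simp⟩

theorem crossVertex_apply {d : ℕ} (q : Fin d × Bool) (j : Fin d) :
    (crossVertex d q).1 j = if j = q.1 then (if q.2 then 1 else -1) else 0 := by
  simp [crossVertex]

theorem crossVertex_injective (d : ℕ) : Function.Injective (crossVertex d) := by
  rintro ⟨i, s⟩ ⟨j, t⟩ h
  have h1 := congrArg (fun x : UnitSphere d => x.1 i) h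
  simp only [crossVertex_apply] at h1
  by_cases hij : i = j
  · subst hij
    cases s <;> cases t <;> first | rfl | norm_num at h1
  · cases s <;> norm_num [hij] at h1

/-- The vertex set of the cross-polytope. -/
noncomputable def crossPolytope (d : ℕ) : Finset (UnitSphere d) :=
  Finset.univ.map ⟨crossVertex d, crossVertex_injective d⟩

theorem sum_crossPolytope {d : ℕ} (f : UnitSphere d → ℝ) :
    ∑ x ∈ crossPolytope d, f x = ∑ i, (f (crossVertex d (i, true)) + f (crossVertex d (i, false))) := by
  simp [crossPolytope, Fintype.sum_prod_type]

theorem card_crossPolytope (d : ℕ) : (crossPolytope d).card = d * 2 := by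
  simp [crossPolytope]

/-- The design property of the cross-polytope for monomials: up to degree 3, a monomial either has
an odd exponent, and both averages vanish by symmetry, or it is `1` or a square `x_i ^ 2`. -/
theorem crossPolytope_monomial {d : ℕ} (hd : 1 ≤ d) (α : Fin d → ℕ) (hα : ∑ i, α i ≤ 3) :
    (1 / ((crossPolytope d).card : ℝ)) * ∑ x ∈ crossPolytope d, ∏ i, x.1 i ^ α i =
        (1 / (surfaceMeasure d).real Set.univ) * ∫ x, ∏ i, x.1 i ^ α i ∂(surfaceMeasure d) := by
  have hσ := integral_sphere_one_ne_zero hd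
  have hd0 : (d : ℝ) ≠ 0 := by positivity
  rw [card_crossPolytope]
  by_cases hodd : ∃ i, Odd (α i)
  · obtain ⟨i, hi⟩ := hodd
    have h1 := integral_sphere_monomial hd α
    rw [Finset.prod_eq_zero (Finset.mem_univ i) (gaussianMoment_odd hi)] at h1
    have hG := Real.Gamma_pos_of_pos (s := (((∑ i, α i : ℕ) : ℝ) + d) / 2) (by positivity)
    have h2 : ∫ x, ∏ i, x.1 i ^ α i ∂(surfaceMeasure d) = 0 := by
      simpa only [mul_eq_zero, div_eq_zero_iff, hG.ne', two_ne_zero, or_false] using h1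
    rw [h2, mul_zero, sum_crossPolytope, Finset.sum_eq_zero, mul_zero]
    intro k _
    rw [← Finset.mul_prod_erase _ _ (Finset.mem_univ i),
      ← Finset.mul_prod_erase _ (fun j => (crossVertex d (k, false)).1 j ^ α j) (Finset.mem_univ i)]
    simp only [crossVertex_apply]
    by_cases hk : i = k
    · rw [Finset.prod_congr rfl (g := fun j => (0 : ℝ) ^ α j)
        (fun j hj => by rw [if_neg (hk ▸ Finset.ne_of_mem_erase hj)]),
        Finset.prod_congr rfl (s₁ := Finset.univ.erase i)
          (f := fun j => (if j = k then (if false = true then (1 : ℝ) else -1) else 0) ^ α j)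
          (g := fun j => (0 : ℝ) ^ α j)
        (fun j hj => by rw [if_neg (hk ▸ Finset.ne_of_mem_erase hj)])]
      subst hk
      simp [hi.neg_one_pow]
    · have : α i ≠ 0 := by rintro h; simp [h] at hi
      simp [hk, this]
  · push Not at hodd
    by_cases hz : ∃ i, α i ≠ 0
    · obtain ⟨i, hi⟩ := hz
      have h1 : α i + ∑ j ∈ Finset.univ.erase i, α j = ∑ j, α j :=
        Finset.add_sum_erase _ _ (Finset.mem_univ i)
      have he : ∀ j, Even (α j) := fun j => Nat.not_odd_iff_even.1 (hodd j)
      have h2 : α i = 2 := by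
        obtain ⟨c, hc⟩ := he i
        omega
      have h3 : ∀ j, j ≠ i → α j = 0 := by
        intro j hj
        have := Finset.single_le_sum (f := α) (fun _ _ => Nat.zero_le _)
          (Finset.mem_erase.2 ⟨hj, Finset.mem_univ j⟩)
        obtain ⟨c, hc⟩ := he j
        omega
      have h4 : ∀ x : UnitSphere d, ∏ j, x.1 j ^ α j = x.1 i ^ 2 := by
        intro x
        rw [Finset.prod_eq_single i (fun j _ hj => by rw [h3 j hj, pow_zero]) (by simp), h2]
      simp only [h4]
      have h5 := integral_sphere_inner_pow_add_two hd (crossVertex d (i, true)) 0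
      have h6 : ∀ x : UnitSphere d, inner ℝ (crossVertex d (i, true)).1 x.1 = x.1 i := by
        intro x; simp [crossVertex, EuclideanSpace.inner_single_left]
      simp only [h6] at h5
      simp at h5
      rw [sum_crossPolytope]
      simp only [crossVertex_apply]
      rw [Finset.sum_eq_single i (fun k _ hk => by simp [hk.symm]) (by simp)]
      norm_num
      field_simp
      linarith
    · push Not at hz
      simp only [hz, pow_zero, Finset.prod_const_one, MeasureTheory.integral_const, Finset.sum_const,
        card_crossPolytope, smul_eq_mul, nsmul_eq_mul, mul_one]
      push_cast
      field_simp

theorem crossPolytope_isSphericalDesign {d : ℕ} (hd : 1 ≤ d) :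
    IsSphericalDesign 3 (crossPolytope d) := by
  refine ⟨Finset.card_pos.1 (by rw [card_crossPolytope]; omega), fun f hf => ?_⟩
  simp only [MvPolynomial.eval_eq']
  rw [MeasureTheory.integral_finsetSum, Finset.sum_comm, Finset.mul_sum, Finset.mul_sum]
  · refine Finset.sum_congr rfl fun s hs => ?_
    rw [← Finset.mul_sum, MeasureTheory.integral_const_mul, mul_left_comm,
      mul_left_comm (1 / (surfaceMeasure d).real Set.univ), crossPolytope_monomial hd s]
    have := MvPolynomial.le_totalDegree hs
    rw [Finsupp.sum_fintype _ _ (by simp)] at this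
    exact this.trans hf
  · intro s _
    refine Continuous.integrable_of_hasCompactSupport ?_ (HasCompactSupport.of_compactSpace _)
    fun_prop

theorem exists_two_stiff {d : ℕ} (hd : 1 ≤ d) : ∃ X : Finset (UnitSphere d), IsStiff 2 X := by
  -- The direction `z = (1, ..., 1) / √d` sees the vertices `± e_i` at heights `± 1 / √d`.
  refine ⟨crossPolytope d, one_le_two, crossPolytope_isSphericalDesign hd, ?_⟩
  have hd0 : (0 : ℝ) < d := by positivity
  have hnorm : ‖(WithLp.toLp 2 fun _ => 1 / √d : EuclideanSpace ℝ (Fin d))‖ = 1 := by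
    rw [EuclideanSpace.norm_eq]
    simp [hd0.ne']
  refine ⟨⟨_, mem_sphere_zero_iff_norm.2 hnorm⟩, ?_⟩
  refine (Set.ncard_le_ncard (t := {1 / √d, -(1 / √d)}) ?_ (Set.toFinite _)).trans ?_
  swap
  · exact (Set.ncard_insert_le _ _).trans (by simp)
  rintro _ ⟨x, hx, rfl⟩
  obtain ⟨⟨i, s⟩, -, rfl⟩ := Finset.mem_map.1 hx
  cases s <;> simp [crossVertex, EuclideanSpace.inner_single_right]

/-! ### The moment functional and the quadrature formula of a design -/

/-- The moments of a coordinate function with respect to the normalised surface measure of the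
sphere `S^{d-1}`, that is, of the weight `(1 - x ^ 2) ^ ((d - 3) / 2)` on `[-1, 1]`. -/
def sphericalMoment (d : ℕ) : ℕ → ℚ
  | 0 => 1
  | 1 => 0
  | k + 2 => (k + 1) / (k + d) * sphericalMoment d k

/-- The moment functional `X ^ k ↦ sphericalMoment d k`, over any field. -/
noncomputable def momentFunctional (F : Type*) [Field F] (d : ℕ) : Polynomial F →ₗ[F] F :=
  Polynomial.lsum fun k => ((sphericalMoment d k : ℚ) : F) • LinearMap.id

open Polynomial

theorem momentFunctional_monomial (F : Type*) [Field F] (d k : ℕ) (a : F) :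
    momentFunctional F d (monomial k a) = a * (sphericalMoment d k : F) := by
  simp [momentFunctional, Polynomial.lsum_apply, Polynomial.sum_monomial_index, mul_comm]

theorem momentFunctional_X_pow (F : Type*) [Field F] (d k : ℕ) :
    momentFunctional F d (X ^ k) = (sphericalMoment d k : F) := by
  rw [X_pow_eq_monomial, momentFunctional_monomial, one_mul]

theorem momentFunctional_map (F : Type*) [Field F] [CharZero F] (d : ℕ) (f : ℚ[X]) :
    momentFunctional F d (f.map (algebraMap ℚ F)) = (momentFunctional ℚ d f : F) := by
  induction f using Polynomial.induction_on' with
  | add p q hp hq => simp [hp, hq]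
  | monomial k a => simp [momentFunctional_monomial]

/-- The Pearson equation of the weight `(1 - x ^ 2) ^ ((d - 3) / 2)`, i.e. integration by parts. -/
theorem momentFunctional_pearson {F : Type*} [Field F] [CharZero F] {d : ℕ} (hd : 1 ≤ d)
    (f : F[X]) :
    momentFunctional F d ((1 - X ^ 2) * derivative f) =
      (d - 1) * momentFunctional F d (X * f) := by
  induction f using Polynomial.induction_on' with
  | add p q hp hq => rw [derivative_add, mul_add, map_add, hp, hq, mul_add, map_add, mul_add]
  | monomial k a =>
    rw [derivative_monomial, sub_mul, one_mul, X_pow_mul_monomial, X_mul_monomial, map_sub]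
    simp only [momentFunctional_monomial]
    rcases k with _ | k
    · simp [sphericalMoment]
    · have h : ((k : F) + d) ≠ 0 := by
        have : ((k + d : ℕ) : F) ≠ 0 := Nat.cast_ne_zero.2 (by omega)
        exact_mod_cast this
      simp only [Nat.add_sub_cancel, sphericalMoment]
      push_cast
      field_simp
      ring

theorem momentFunctional_pearson_mul {F : Type*} [Field F] [CharZero F] {d : ℕ} (hd : 1 ≤ d)
    (f g : F[X]) :
    momentFunctional F d ((1 - X ^ 2) * derivative f * g) =
      (d - 1) * momentFunctional F d (f * (X * g)) -
        momentFunctional F d (f * ((1 - X ^ 2) * derivative g)) := by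
  have h := momentFunctional_pearson hd (f * g)
  rw [derivative_mul, mul_add, map_add] at h
  rw [← mul_assoc] at h
  rw [show f * (X * g) = X * (f * g) by ring, ← h,
    show f * ((1 - X ^ 2) * derivative g) = (1 - X ^ 2) * (f * derivative g) by ring]
  ring

/-- The average of `⟨z, x⟩ ^ k` over the sphere. -/
theorem average_inner_pow {d : ℕ} (hd : 1 ≤ d) (z : UnitSphere d) (k : ℕ) :
    (1 / (surfaceMeasure d).real Set.univ) * ∫ x, (inner ℝ z.1 x.1 : ℝ) ^ k ∂(surfaceMeasure d) =
      (sphericalMoment d k : ℝ) := by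
  have hσ := integral_sphere_one_ne_zero hd
  induction k using sphericalMoment.induct with
  | case1 => simp [sphericalMoment, hσ]
  | case2 => simp [sphericalMoment, integral_sphere_inner hd z]
  | case3 k ih =>
    have h := integral_sphere_inner_pow_add_two hd z k
    have hk : ((k : ℝ) + d) ≠ 0 := by positivity
    rw [sphericalMoment]
    push_cast
    rw [← ih]
    field_simp
    linear_combination h

/-- A spherical design integrates univariate polynomials in `⟨z, x⟩` exactly. -/
theorem IsSphericalDesign.sum_eval_inner {d t : ℕ} (hd : 1 ≤ d) {X : Finset (UnitSphere d)}
    (hX : IsSphericalDesign t X) (z : UnitSphere d) (f : ℝ[X]) (hf : f.natDegree ≤ t) :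
    (1 / (X.card : ℝ)) * ∑ x ∈ X, f.eval (inner ℝ z.1 x.1) = momentFunctional ℝ d f := by
  have key : ∀ k ≤ t, (1 / (X.card : ℝ)) * ∑ x ∈ X, (inner ℝ z.1 x.1 : ℝ) ^ k =
      (sphericalMoment d k : ℝ) := by
    intro k hk
    have h := hX.2 ((∑ i, MvPolynomial.C (z.1 i) * MvPolynomial.X i) ^ k) ?_
    · have he : ∀ x : UnitSphere d, MvPolynomial.eval (fun i => x.1 i)
          ((∑ i, MvPolynomial.C (z.1 i) * MvPolynomial.X i) ^ k) = (inner ℝ z.1 x.1 : ℝ) ^ k := by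
        intro x
        simp [PiLp.inner_apply, mul_comm]
      simp only [he] at h
      rw [h, average_inner_pow hd]
    · refine (MvPolynomial.totalDegree_pow _ _).trans ((Nat.mul_le_mul_left k ?_).trans
        ((mul_one k).trans_le hk))
      refine MvPolynomial.totalDegree_finsetSum_le fun i _ => ?_
      refine (MvPolynomial.totalDegree_mul _ _).trans ?_
      simp
  rw [f.as_sum_range' (t + 1) (by omega)]
  simp only [eval_finsetSum, map_sum, momentFunctional_monomial, eval_monomial]
  rw [Finset.sum_comm, Finset.mul_sum]
  refine Finset.sum_congr rfl fun k hk => ?_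
  rw [← key k (by simpa [Nat.lt_succ_iff] using hk), ← Finset.mul_sum]
  ring

/-- The inner products of a design with a fixed point are the nodes of a quadrature formula with
positive rational weights. -/
theorem IsSphericalDesign.exists_quadrature {d t : ℕ} (hd : 1 ≤ d) {X : Finset (UnitSphere d)}
    (hX : IsSphericalDesign t X) (z : UnitSphere d) :
    ∃ (T : Finset ℝ) (w : ℝ → ℚ), (T : Set ℝ) = innerProducts z X ∧ (∀ τ ∈ T, |τ| ≤ 1) ∧
      (∀ τ ∈ T, 0 < w τ) ∧ ∀ f : ℝ[X], f.natDegree ≤ t →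
        ∑ τ ∈ T, (w τ : ℝ) * f.eval τ = momentFunctional ℝ d f := by
  classical
  let g : UnitSphere d → ℝ := fun x => inner ℝ z.1 x.1
  have hc : 0 < X.card := Finset.card_pos.2 hX.1
  refine ⟨X.image g, fun τ => ((X.filter fun x => g x = τ).card : ℚ) / X.card, ?_, ?_, ?_, ?_⟩
  · ext s
    simp only [Finset.coe_image, Set.mem_image, Finset.mem_coe, innerProducts, g]
    exact ⟨fun ⟨x, h, e⟩ => ⟨x, h, e.symm⟩, fun ⟨x, h, e⟩ => ⟨x, h, e.symm⟩⟩
  · intro τ hτ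
    obtain ⟨x, -, rfl⟩ := Finset.mem_image.1 hτ
    refine (abs_real_inner_le_norm _ _).trans ?_
    simp
  · intro τ hτ
    obtain ⟨x, hx, rfl⟩ := Finset.mem_image.1 hτ
    have : 0 < (X.filter fun y => g y = g x).card :=
      Finset.card_pos.2 ⟨x, Finset.mem_filter.2 ⟨hx, rfl⟩⟩
    positivity
  · intro f hf
    rw [← hX.sum_eval_inner hd z f hf, Finset.sum_comp (fun s => f.eval s) g, Finset.mul_sum]
    refine Finset.sum_congr rfl fun τ _ => ?_
    rw [nsmul_eq_mul]
    push_cast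
    ring

/-! ### Gauss quadrature for the spherical moments -/

section Quadrature

variable {d m : ℕ} {T : Finset ℝ} {w : ℝ → ℝ}

/-- The second moment `1 / d` is not `1`, so the nodes are not all `± 1`. -/
theorem exists_node_sq_ne_one (hd : 2 ≤ d) (hm : 2 ≤ m)
    (hQ : ∀ f : ℝ[X], f.natDegree ≤ 2 * m - 1 →
      ∑ τ ∈ T, w τ * f.eval τ = momentFunctional ℝ d f) : ∃ τ ∈ T, 1 - τ ^ 2 ≠ 0 := by
  by_contra! h
  have h0 := hQ (X ^ 0) (by simp)
  have h2 := hQ (X ^ 2) (by rw [natDegree_X_pow]; omega)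
  rw [momentFunctional_X_pow] at h0 h2
  have : ∑ τ ∈ T, w τ * (X ^ 2 : ℝ[X]).eval τ = ∑ τ ∈ T, w τ * (X ^ 0 : ℝ[X]).eval τ := by
    refine Finset.sum_congr rfl fun τ hτ => ?_
    simp only [eval_pow, eval_X, pow_zero, eval_one]
    linear_combination w τ * (- h τ hτ)
  rw [this, h0] at h2
  simp only [sphericalMoment] at h2
  have hd' : (2 : ℝ) ≤ d := by exact_mod_cast hd
  field_simp at h2
  push_cast at h2
  field_simp at h2
  linarith

theorem nodal_eval_derivative_ne_zero {τ : ℝ} (hτ : τ ∈ T) :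
    (derivative (Lagrange.nodal T id)).eval τ ≠ 0 := by
  have := Lagrange.eval_nodal_derivative_eval_node_eq (v := id) hτ
  rw [id] at this
  rw [this, Lagrange.eval_nodal]
  refine Finset.prod_ne_zero_iff.2 fun σ hσ => ?_
  exact sub_ne_zero.2 (Finset.ne_of_mem_erase hσ).symm

/-- The node polynomial is orthogonal to all polynomials of complementary degree. -/
theorem momentFunctional_nodal_mul
    (hQ : ∀ f : ℝ[X], f.natDegree ≤ 2 * m - 1 →
      ∑ τ ∈ T, w τ * f.eval τ = momentFunctional ℝ d f)
    (g : ℝ[X]) (hg : T.card + g.natDegree ≤ 2 * m - 1) :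
    momentFunctional ℝ d (Lagrange.nodal T id * g) = 0 := by
  rw [← hQ]
  · refine Finset.sum_eq_zero fun τ hτ => ?_
    have := Lagrange.eval_nodal_at_node (v := id) hτ
    rw [id] at this
    rw [eval_mul, this]
    ring
  · refine natDegree_mul_le.trans ?_
    rwa [Lagrange.natDegree_nodal]

theorem natDegree_one_sub_X_sq_mul_le (f : ℝ[X]) :
    ((1 - X ^ 2) * f).natDegree ≤ f.natDegree + 2 := by
  refine natDegree_mul_le.trans ?_
  have : (1 - X ^ 2 : ℝ[X]).natDegree ≤ 2 := by compute_degree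
  omega

theorem natDegree_X_mul_le' (f : ℝ[X]) : (X * f).natDegree ≤ f.natDegree + 1 := by
  refine natDegree_mul_le.trans ?_
  rw [natDegree_X, add_comm]

/-- A quadrature formula of degree `2 * m - 1` for the spherical moments needs `m` nodes: with
fewer nodes, integration by parts applied to the node polynomial `N` gives that the integral of
`(1 - x ^ 2) * N' ^ 2` vanishes, which forces all nodes to be `± 1`. -/
theorem card_nodes_eq (hd : 2 ≤ d) (hm : 2 ≤ m) (hT : T.card ≤ m) (h1 : ∀ τ ∈ T, |τ| ≤ 1)
    (hw : ∀ τ ∈ T, 0 < w τ)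
    (hQ : ∀ f : ℝ[X], f.natDegree ≤ 2 * m - 1 →
      ∑ τ ∈ T, w τ * f.eval τ = momentFunctional ℝ d f) : T.card = m := by
  by_contra hne
  set N := Lagrange.nodal T (id : ℝ → ℝ) with hN
  have hNd : N.natDegree = T.card := Lagrange.natDegree_nodal
  have hN' : (derivative N).natDegree ≤ T.card - 1 := (natDegree_derivative_le N).trans (by omega)
  have hN'' : (derivative (derivative N)).natDegree ≤ T.card - 1 - 1 :=
    (natDegree_derivative_le _).trans (by omega)
  obtain ⟨τ, hτ, hτ1⟩ := exists_node_sq_ne_one hd hm hQ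
  have hpos : 1 ≤ T.card := Finset.card_pos.2 ⟨τ, hτ⟩
  have h := momentFunctional_pearson_mul (F := ℝ) (d := d) (by omega) N (derivative N)
  have hX := natDegree_X_mul_le' (derivative N)
  have hY : ((1 - X ^ 2) * derivative (derivative N)).natDegree ≤ T.card := by
    rcases Nat.lt_or_ge T.card 2 with hlt | hge
    · have : derivative (derivative N) = 0 := by
        rw [derivative_of_natDegree_zero]; omega
      rw [this]; simp
    · have := natDegree_one_sub_X_sq_mul_le (derivative (derivative N))
      omega
  rw [momentFunctional_nodal_mul hQ _ (by omega), momentFunctional_nodal_mul hQ _ (by omega),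
    ← hQ] at h
  · rw [mul_zero, sub_zero, Finset.sum_eq_zero_iff_of_nonneg] at h
    · have h3 := h τ hτ
      simp only [eval_mul, eval_sub, eval_one, eval_pow, eval_X, mul_eq_zero] at h3
      have h4 := nodal_eval_derivative_ne_zero hτ
      have h5 := (hw τ hτ).ne'
      tauto
    · intro σ hσ
      have h3 : 0 ≤ 1 - σ ^ 2 := by
        have := sq_le_one_iff_abs_le_one σ |>.2 (h1 σ hσ)
        linarith
      have h4 := (hw σ hσ).le
      simp only [eval_mul, eval_sub, eval_one, eval_pow, eval_X, mul_assoc, ← pow_two]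
      positivity
  · refine natDegree_mul_le.trans ?_
    have := natDegree_one_sub_X_sq_mul_le (derivative N)
    omega

/-- The Gegenbauer differential operator `(1 - x ^ 2) f'' - (d - 1) x f'`. -/
noncomputable def gegenbauerOp (d : ℕ) (f : ℝ[X]) : ℝ[X] :=
  (1 - X ^ 2) * derivative (derivative f) - (d - 1 : ℝ[X]) * (X * derivative f)

theorem coeff_gegenbauerOp (d : ℕ) (f : ℝ[X]) (j : ℕ) :
    (gegenbauerOp d f).coeff j =
      (j + 2) * (j + 1) * f.coeff (j + 2) - j * (j + d - 2) * f.coeff j := by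
  have hC : (d - 1 : ℝ[X]) = C ((d : ℝ) - 1) := by simp
  rw [gegenbauerOp, hC, sub_mul, one_mul]
  simp only [coeff_sub, coeff_C_mul, coeff_derivative, coeff_X_pow_mul']
  rcases j with _ | _ | j
  · simp [coeff_derivative]; ring
  · simp [coeff_derivative, coeff_X_mul]; ring
  · simp [coeff_derivative, coeff_X_mul]; ring

/-- The node polynomial `N` satisfies the Gegenbauer differential equation: the operator is symmetric
for the moment functional, so the left-hand side, of degree less than `m`, is orthogonal to itself
and vanishes at all nodes. -/
theorem gegenbauerOp_nodal (hd : 2 ≤ d) (hm : 2 ≤ m) (hT : T.card = m)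
    (hw : ∀ τ ∈ T, 0 < w τ)
    (hQ : ∀ f : ℝ[X], f.natDegree ≤ 2 * m - 1 →
      ∑ τ ∈ T, w τ * f.eval τ = momentFunctional ℝ d f) :
    gegenbauerOp d (Lagrange.nodal T id) + C (m * (m + d - 2) : ℝ) * Lagrange.nodal T id = 0 := by
  set N := Lagrange.nodal T (id : ℝ → ℝ) with hN
  have hNd : N.natDegree = m := Lagrange.natDegree_nodal.trans hT
  set E := gegenbauerOp d N + C (m * (m + d - 2) : ℝ) * N with hE
  have hEd : E.natDegree ≤ m - 1 := by
    rw [natDegree_le_iff_coeff_eq_zero]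
    intro j hj
    rw [hE, coeff_add, coeff_gegenbauerOp, coeff_C_mul,
      coeff_eq_zero_of_natDegree_lt (n := j + 2) (by omega)]
    rcases eq_or_ne j m with rfl | hne
    · ring
    · rw [coeff_eq_zero_of_natDegree_lt (n := j) (by omega)]
      ring
  have horth : ∀ g : ℝ[X], g.natDegree ≤ m - 1 → momentFunctional ℝ d (E * g) = 0 := by
    intro g hg
    have hg' : (derivative g).natDegree ≤ m - 1 - 1 :=
      (natDegree_derivative_le _).trans (by omega)
    have hg'' : (derivative (derivative g)).natDegree ≤ m - 1 - 1 - 1 :=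
      (natDegree_derivative_le _).trans (by omega)
    have p1 := momentFunctional_pearson_mul (F := ℝ) (d := d) (by omega) (derivative N) g
    have p2 := momentFunctional_pearson_mul (F := ℝ) (d := d) (by omega) N (derivative g)
    have z1 := momentFunctional_nodal_mul hQ g (by omega)
    have z2 := momentFunctional_nodal_mul hQ (X * derivative g)
      (by have := natDegree_X_mul_le' (derivative g); omega)
    have z3 := momentFunctional_nodal_mul hQ ((1 - X ^ 2) * derivative (derivative g)) (by
      rcases Nat.lt_or_ge g.natDegree 2 with hlt | hge
      · have : derivative (derivative g) = 0 := by
          rw [derivative_of_natDegree_zero]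
          have := natDegree_derivative_le g
          omega
        rw [this]; simp; omega
      · have := natDegree_one_sub_X_sq_mul_le (derivative (derivative g))
        omega)
    have e : E * g = (1 - X ^ 2) * derivative (derivative N) * g -
        ((d : ℝ) - 1) • (derivative N * (X * g)) + (m * (m + d - 2) : ℝ) • (N * g) := by
      rw [hE, gegenbauerOp]
      simp only [smul_eq_C_mul]
      simp only [C_sub, map_natCast, C_1]
      ring
    have e2 : derivative N * ((1 - X ^ 2) * derivative g) = (1 - X ^ 2) * derivative N * derivative g := by
      ring
    rw [e2, p2] at p1
    rw [e, map_add, map_sub, map_smul, map_smul, p1, z1, z2, z3]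
    simp
  refine eq_zero_of_natDegree_lt_card_of_eval_eq_zero' E T (fun τ hτ => ?_) (by omega)
  have h := horth E hEd
  rw [← hQ _ (natDegree_mul_le.trans (by omega)), Finset.sum_eq_zero_iff_of_nonneg] at h
  · have := h τ hτ
    rw [eval_mul] at this
    simpa [(hw τ hτ).ne'] using this
  · intro σ hσ
    rw [eval_mul]
    exact mul_nonneg (hw σ hσ).le (mul_self_nonneg _)

/-- The weights of the quadrature formula are inversely proportional to the values of
`(1 - x ^ 2) * N' ^ 2` at the nodes: the polynomial `F = (1 - x ^ 2) * N' + m * x * N` has degree at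
most `m` and is orthogonal to degree `m - 2`, so pairing it with `N / (x - τ)` gives a value that does
not depend on the node `τ`. -/
theorem weight_mul_eq (hd : 2 ≤ d) (hm : 2 ≤ m) (hT : T.card = m)
    (hQ : ∀ f : ℝ[X], f.natDegree ≤ 2 * m - 1 →
      ∑ τ ∈ T, w τ * f.eval τ = momentFunctional ℝ d f) {τ : ℝ} (hτ : τ ∈ T) :
    w τ * ((1 - τ ^ 2) * (derivative (Lagrange.nodal T id)).eval τ ^ 2) =
      momentFunctional ℝ d (((1 - X ^ 2) * derivative (Lagrange.nodal T id) +
        (m : ℝ[X]) * (X * Lagrange.nodal T id)) * X ^ (m - 1)) := by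
  classical
  set N := Lagrange.nodal T (id : ℝ → ℝ) with hN
  have hNd : N.natDegree = m := Lagrange.natDegree_nodal.trans hT
  have hN' : (derivative N).natDegree ≤ m - 1 := (natDegree_derivative_le N).trans (by omega)
  have hNm : N.coeff m = 1 := by
    have := (Lagrange.nodal_monic (s := T) (v := (id : ℝ → ℝ))).coeff_natDegree
    rwa [Lagrange.natDegree_nodal, hT] at this
  set F := (1 - X ^ 2) * derivative N + (m : ℝ[X]) * (X * N) with hF
  have hFd : F.natDegree ≤ m := by
    rw [natDegree_le_iff_coeff_eq_zero]
    intro j hj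
    have hC : (m : ℝ[X]) = C (m : ℝ) := by simp
    obtain ⟨i, rfl⟩ : ∃ i, j = i + 2 := ⟨j - 2, by omega⟩
    rw [hF, sub_mul, one_mul, coeff_add, coeff_sub, hC, coeff_C_mul, coeff_X_mul,
      coeff_X_pow_mul, coeff_derivative, coeff_derivative,
      coeff_eq_zero_of_natDegree_lt (n := i + 2 + 1) (by omega)]
    rcases eq_or_ne m (i + 1) with h | hne
    · rw [← h, hNm, h]; push_cast; ring
    · rw [coeff_eq_zero_of_natDegree_lt (n := i + 1) (by omega)]
      ring
  have horth : ∀ g : ℝ[X], g.natDegree ≤ m - 2 → momentFunctional ℝ d (F * g) = 0 := by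
    intro g hg
    have hg' : (derivative g).natDegree ≤ m - 2 - 1 :=
      (natDegree_derivative_le _).trans (by omega)
    have p1 := momentFunctional_pearson_mul (F := ℝ) (d := d) (by omega) N g
    have z1 := momentFunctional_nodal_mul hQ (X * g)
      (by have := natDegree_X_mul_le' g; omega)
    have z2 := momentFunctional_nodal_mul hQ ((1 - X ^ 2) * derivative g)
      (by
        rcases Nat.eq_zero_or_pos g.natDegree with h0 | hpos
        · rw [derivative_of_natDegree_zero h0]; simp; omega
        · have := natDegree_one_sub_X_sq_mul_le (derivative g)
          omega)
    have e : F * g = (1 - X ^ 2) * derivative N * g + (m : ℝ) • (N * (X * g)) := by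
      rw [hF, smul_eq_C_mul, map_natCast]
      ring
    rw [e, map_add, map_smul, p1, z1, z2]
    simp
  set ℓ := Lagrange.nodal (T.erase τ) (id : ℝ → ℝ) with hℓ
  have hcard : (T.erase τ).card = m - 1 := by rw [Finset.card_erase_of_mem hτ, hT]
  have hℓd : ℓ.natDegree = m - 1 := Lagrange.natDegree_nodal.trans hcard
  have hℓN : (derivative N).eval τ = ℓ.eval τ := by
    have := Lagrange.eval_nodal_derivative_eval_node_eq (v := (id : ℝ → ℝ)) hτ
    exact this
  have hNτ : N.eval τ = 0 := Lagrange.eval_nodal_at_node (v := (id : ℝ → ℝ)) hτ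
  -- `ℓ` and `X ^ (m - 1)` are monic of the same degree, so only the leading term contributes.
  have hlow : (ℓ - X ^ (m - 1)).natDegree ≤ m - 2 := by
    rw [natDegree_le_iff_coeff_eq_zero]
    intro j hj
    rw [coeff_sub, coeff_X_pow]
    split_ifs with h
    · have := (Lagrange.nodal_monic (s := T.erase τ) (v := (id : ℝ → ℝ))).coeff_natDegree
      rw [Lagrange.natDegree_nodal, hcard] at this
      rw [h, this, sub_self]
    · rw [coeff_eq_zero_of_natDegree_lt (by omega), sub_zero]
  have h1 := horth _ hlow
  rw [mul_sub, map_sub, sub_eq_zero] at h1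
  rw [← h1, ← hQ _ (natDegree_mul_le.trans (by omega)), Finset.sum_eq_single τ]
  · rw [eval_mul, ← hℓN, hF]
    simp only [eval_add, eval_mul, eval_sub, eval_one, eval_pow, eval_X, hNτ]
    ring
  · intro σ hσ hne
    have : ℓ.eval σ = 0 :=
      Lagrange.eval_nodal_at_node (v := (id : ℝ → ℝ)) (Finset.mem_erase.2 ⟨hne, hσ⟩)
    rw [eval_mul, this]
    ring
  · exact fun h => absurd hτ h

end Quadrature

/-! ### Hypergeometric form and rationality at the roots -/

/-- Coefficients of the terminating hypergeometric series
`₂F₁(-n, n + l; b + 1/2; y)`. -/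
def hypCoeff (n l b : ℕ) : ℕ → ℚ
  | 0 => 1
  | j + 1 => -(2 * ((n : ℚ) - j) * (n + l + j)) / ((j + 1) * (2 * b + 2 * j + 1)) * hypCoeff n l b j

/-- The polynomial `₂F₁(-n, n + l; b + 1/2; y)`. For `b = 0` and `y = x ^ 2` it is proportional to
the Gegenbauer polynomial of degree `2 * n` and parameter `l`; for `b = l` it is proportional to the
same polynomial written in terms of `1 - x ^ 2`. -/
noncomputable def hypPoly (n l b : ℕ) : ℚ[X] :=
  ∑ j ∈ Finset.range (n + 1), monomial j (hypCoeff n l b j)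

theorem hypCoeff_succ (n l b j : ℕ) :
    ((j : ℚ) + 1) * (2 * b + 2 * j + 1) * hypCoeff n l b (j + 1) =
      -(2 * ((n : ℚ) - j) * (n + l + j)) * hypCoeff n l b j := by
  have h1 : ((j : ℚ) + 1) ≠ 0 := by positivity
  have h2 : (2 * b + 2 * j + 1 : ℚ) ≠ 0 := by positivity
  rw [hypCoeff]
  field_simp

theorem hypCoeff_eq_zero {n l b j : ℕ} (h : n < j) : hypCoeff n l b j = 0 := by
  induction j, h using Nat.le_induction with
  | base => simp [hypCoeff]
  | succ j _ ih => rw [hypCoeff, ih, mul_zero]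

theorem coeff_hypPoly (n l b j : ℕ) : (hypPoly n l b).coeff j = hypCoeff n l b j := by
  simp only [hypPoly, finsetSum_coeff, coeff_monomial]
  rw [Finset.sum_ite_eq' (Finset.range (n + 1)) j, ite_eq_left_iff]
  intro h
  rw [hypCoeff_eq_zero (by simpa using h)]

theorem hypPoly_ne_zero (n l b : ℕ) : hypPoly n l b ≠ 0 := by
  intro h
  have := coeff_hypPoly n l b 0
  simp [h, hypCoeff] at this

/-- The coefficient recursion determines `hypPoly` up to a constant factor. -/
theorem eq_C_mul_hypPoly {F : Type*} [Field F] [CharZero F] {n l b : ℕ} {f : F[X]}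
    (hf : ∀ j : ℕ, ((j : F) + 1) * (2 * b + 2 * j + 1) * f.coeff (j + 1) =
      -(2 * ((n : F) - j) * (n + l + j)) * f.coeff j) :
    f = C (f.coeff 0) * (hypPoly n l b).map (algebraMap ℚ F) := by
  ext j
  rw [coeff_C_mul, coeff_map, coeff_hypPoly]
  induction j with
  | zero => simp [hypCoeff]
  | succ j ih =>
    have h1 : ((j : F) + 1) ≠ 0 := Nat.cast_add_one_ne_zero j
    have h2 : (2 * b + 2 * j + 1 : F) ≠ 0 := by
      exact_mod_cast Nat.cast_add_one_ne_zero (R := F) (2 * b + 2 * j)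
    have h3 := congrArg (algebraMap ℚ F) (hypCoeff_succ n l b j)
    simp only [map_mul, map_add, map_neg, map_sub, map_natCast, map_one, map_ofNat] at h3
    have h4 := hf j
    rw [ih] at h4
    apply mul_left_cancel₀ (mul_ne_zero h1 h2)
    linear_combination h4 - f.coeff 0 * h3

/-- The coefficient recursion of `hypPoly`, as a hypergeometric differential equation. -/
theorem coeff_hypergeometric_ode {F : Type*} [CommRing F] (n l b : ℕ) (f : F[X]) (j : ℕ) :
    (2 * X * (1 - X) * derivative (derivative f) +
      (((2 * b + 1 : ℕ) : F[X]) - ((2 * (l + 1) : ℕ) : F[X]) * X) * derivative f +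
      ((2 * n * (n + l) : ℕ) : F[X]) * f).coeff j =
    ((j : F) + 1) * (2 * b + 2 * j + 1) * f.coeff (j + 1) +
      (2 * ((n : F) - j) * (n + l + j)) * f.coeff j := by
  have e : (2 * X * (1 - X) * derivative (derivative f) +
      (((2 * b + 1 : ℕ) : F[X]) - ((2 * (l + 1) : ℕ) : F[X]) * X) * derivative f +
      ((2 * n * (n + l) : ℕ) : F[X]) * f) =
      C 2 * (X * derivative (derivative f)) - C 2 * (X * (X * derivative (derivative f))) +
      C ((2 * b + 1 : ℕ) : F) * derivative f - C ((2 * (l + 1) : ℕ) : F) * (X * derivative f) +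
      C ((2 * n * (n + l) : ℕ) : F) * f := by
    simp only [map_natCast, map_ofNat]
    ring
  rw [e]
  simp only [coeff_add, coeff_sub, coeff_C_mul, coeff_derivative]
  rcases j with _ | _ | j
  · simp [coeff_derivative]
  · simp [coeff_derivative, coeff_X_mul]; ring
  · simp [coeff_derivative, coeff_X_mul]; ring

/-- The substitution `y ↦ 1 - y` exchanges the hypergeometric polynomials at the two singular points
`0` and `1`. -/
theorem hypPoly_comp_one_sub_X (n l : ℕ) :
    ∃ a : ℚ, a ≠ 0 ∧ (hypPoly n l 0).comp (1 - X) = C a * hypPoly n l l := by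
  set A := hypPoly n l 0 with hA
  have hode : 2 * X * (1 - X) * derivative (derivative A) +
      (((2 * 0 + 1 : ℕ) : ℚ[X]) - ((2 * (l + 1) : ℕ) : ℚ[X]) * X) * derivative A +
      ((2 * n * (n + l) : ℕ) : ℚ[X]) * A = 0 := by
    ext j
    rw [coeff_hypergeometric_ode, hA, coeff_hypPoly, coeff_hypPoly, hypCoeff_succ, coeff_zero]
    ring
  have hcomp := congrArg (fun f : ℚ[X] => f.comp (1 - X)) hode
  simp only [add_comp, mul_comp, sub_comp, X_comp, one_comp, ofNat_comp, natCast_comp,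
    zero_comp] at hcomp
  have hrec := eq_C_mul_hypPoly (n := n) (l := l) (b := l) (f := A.comp (1 - X)) (fun j => by
    have h := coeff_hypergeometric_ode n l l (A.comp (1 - X)) j
    rw [eq_neg_of_add_eq_zero_left (h.symm.trans ?_), neg_mul]
    refine (congrArg (fun f : ℚ[X] => f.coeff j) ?_).trans (coeff_zero j)
    have hd1 : derivative (A.comp (1 - X)) = - (derivative A).comp (1 - X) := by
      rw [derivative_comp]; simp
    have hd2 : derivative (- (derivative A).comp (1 - X)) =
        (derivative (derivative A)).comp (1 - X) := by
      rw [derivative_neg, derivative_comp]; simp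
    rw [hd1, hd2, ← hcomp]
    push_cast
    ring)
  have hmap (φ : ℚ →+* ℚ) : (hypPoly n l l).map φ = hypPoly n l l := by
    rw [Subsingleton.elim φ (RingHom.id ℚ), map_id]
  rw [hmap] at hrec
  refine ⟨_, fun h0 => ?_, hrec⟩
  rw [h0, C_0, zero_mul] at hrec
  have h1 : (A.comp (1 - X)).comp (1 - X) = 0 := by rw [hrec, zero_comp]
  rw [comp_assoc] at h1
  simp only [sub_comp, one_comp, X_comp, sub_sub_cancel, comp_X] at h1
  exact hypPoly_ne_zero n l 0 h1

section Values

variable {n l : ℕ} {T : Finset ℝ} {w : ℝ → ℚ}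

/-- The node polynomial is, up to a rational factor, the even Gegenbauer polynomial. -/
theorem nodal_eq (hn : 1 ≤ n) (hT : T.card = 2 * n)
    (hw : ∀ τ ∈ T, 0 < w τ)
    (hQ : ∀ f : ℝ[X], f.natDegree ≤ 2 * (2 * n) - 1 →
      ∑ τ ∈ T, (w τ : ℝ) * f.eval τ = momentFunctional ℝ (2 * l + 2) f) :
    ∃ a : ℚ, a ≠ 0 ∧
      Lagrange.nodal T id = (C a * expand ℚ 2 (hypPoly n l 0)).map (algebraMap ℚ ℝ) := by
  set N := Lagrange.nodal T (id : ℝ → ℝ) with hN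
  have hNd : N.natDegree = 2 * n := Lagrange.natDegree_nodal.trans hT
  have hNm : N.coeff (2 * n) = 1 := by
    have := (Lagrange.nodal_monic (s := T) (v := (id : ℝ → ℝ))).coeff_natDegree
    rwa [Lagrange.natDegree_nodal, hT] at this
  have hode := gegenbauerOp_nodal (d := 2 * l + 2) (m := 2 * n) (w := fun τ => (w τ : ℝ))
    (by omega) (by omega) hT (fun τ hτ => by exact_mod_cast hw τ hτ) hQ
  have hrec : ∀ j : ℕ, ((j : ℝ) + 2) * (j + 1) * N.coeff (j + 2) =
      (j - 2 * n) * (j + 2 * n + 2 * l) * N.coeff j := by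
    intro j
    have := congrArg (fun f : ℝ[X] => f.coeff j) hode
    simp only [coeff_add, coeff_gegenbauerOp, coeff_C_mul, coeff_zero] at this
    push_cast at this
    linear_combination this
  have hodd : ∀ k i, 2 * i + 1 + 2 * k = 2 * n + 1 → N.coeff (2 * i + 1) = 0 := by
    intro k
    induction k with
    | zero => intro i hi; exact coeff_eq_zero_of_natDegree_lt (by omega)
    | succ k ih =>
      intro i hi
      have h := hrec (2 * i + 1)
      rw [show 2 * i + 1 + 2 = 2 * (i + 1) + 1 by ring, ih (i + 1) (by omega), mul_zero] at h
      have h1 : (((2 * i + 1 : ℕ) : ℝ) - 2 * n) ≠ 0 := by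
        rw [sub_ne_zero]
        exact_mod_cast (by omega : 2 * i + 1 ≠ 2 * n)
      have h2 : (((2 * i + 1 : ℕ) : ℝ) + 2 * n + 2 * l) ≠ 0 := by positivity
      exact (mul_eq_zero.1 h.symm).resolve_left (mul_ne_zero h1 h2)
  have hexp : N = expand ℝ 2 (contract 2 N) := by
    ext j
    rw [coeff_expand two_pos]
    split_ifs with h
    · rw [coeff_contract two_ne_zero, Nat.div_mul_cancel h]
    · obtain ⟨i, rfl⟩ : ∃ i, j = 2 * i + 1 := ⟨j / 2, by omega⟩
      rcases Nat.lt_or_ge n i with hlt | hge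
      · exact coeff_eq_zero_of_natDegree_lt (by omega)
      · exact hodd (n - i) i (by omega)
  have hA := eq_C_mul_hypPoly (n := n) (l := l) (b := 0) (f := contract 2 N) (fun j => by
    rw [coeff_contract two_ne_zero, coeff_contract two_ne_zero]
    have h := hrec (j * 2)
    rw [show (j + 1) * 2 = j * 2 + 2 by ring]
    push_cast at h ⊢
    linear_combination h / 2)
  set c := (contract 2 N).coeff 0
  have hlead : c * (hypCoeff n l 0 n : ℝ) = 1 := by
    have h := congrArg (fun f : ℝ[X] => f.coeff n) hA
    simp only [coeff_contract two_ne_zero, coeff_C_mul, coeff_map, coeff_hypPoly] at h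
    rw [mul_comm n 2, hNm] at h
    exact h.symm
  have hne : hypCoeff n l 0 n ≠ 0 := by
    intro h
    simp [h] at hlead
  refine ⟨(hypCoeff n l 0 n)⁻¹, inv_ne_zero hne, ?_⟩
  have hc : c = ((hypCoeff n l 0 n)⁻¹ : ℚ) := by
    push_cast
    exact eq_inv_of_mul_eq_one_left hlead
  rw [hexp, hA, map_mul, expand_C, Polynomial.map_mul, map_C, ← map_expand, hc]
  simp

/-- If the weights are rational, then `y (1 - y) A'(y) ^ 2` is rational at every root `y` of
`A = ₂F₁(-n, n + l; 1/2; y)`, in every algebraically closed field of characteristic zero. -/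
theorem rational_at_roots_zero (hn : 1 ≤ n) (hT : T.card ≤ 2 * n) (h1 : ∀ τ ∈ T, |τ| ≤ 1)
    (hw : ∀ τ ∈ T, 0 < w τ)
    (hQ : ∀ f : ℝ[X], f.natDegree ≤ 2 * (2 * n) - 1 →
      ∑ τ ∈ T, (w τ : ℝ) * f.eval τ = momentFunctional ℝ (2 * l + 2) f)
    {K : Type*} [Field K] [CharZero K] [IsAlgClosed K] {y : K}
    (hy : aeval y (hypPoly n l 0) = 0) :
    ∃ c : ℚ, y * (1 - y) * aeval y (derivative (hypPoly n l 0)) ^ 2 = c := by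
  classical
  have hw' : ∀ τ ∈ T, (0 : ℝ) < w τ := fun τ hτ => by exact_mod_cast hw τ hτ
  have hTc : T.card = 2 * n := card_nodes_eq (d := 2 * l + 2) (m := 2 * n)
    (w := fun τ => (w τ : ℝ)) (by omega) (by omega) hT h1 hw' hQ
  obtain ⟨a, ha, hN⟩ := nodal_eq hn hTc hw hQ
  set A := hypPoly n l 0 with hA
  set q : ℚ[X] := X * (1 - X) * derivative A ^ 2 with hq
  have haR : (a : ℝ) ≠ 0 := by exact_mod_cast ha
  have hval : ∀ τ ∈ T, ∃ c : ℚ, (expand ℚ 2 q).eval₂ (algebraMap ℚ ℝ) τ = c := by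
    intro τ hτ
    have hk := weight_mul_eq (d := 2 * l + 2) (m := 2 * n) (w := fun τ => (w τ : ℝ))
      (by omega) (by omega) hTc hQ hτ
    set NQ : ℚ[X] := C a * expand ℚ 2 A with hNQ
    have hmap : ((1 - X ^ 2) * derivative (Lagrange.nodal T id) +
        ((2 * n : ℕ) : ℝ[X]) * (X * Lagrange.nodal T id)) * X ^ (2 * n - 1) =
        (((1 - X ^ 2) * derivative NQ + ((2 * n : ℕ) : ℚ[X]) * (X * NQ)) *
          X ^ (2 * n - 1)).map (algebraMap ℚ ℝ) := by
      rw [hN]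
      simp [derivative_map]
    rw [hmap, momentFunctional_map] at hk
    generalize momentFunctional ℚ (2 * l + 2) _ = κ at hk
    refine ⟨κ / (4 * a ^ 2 * w τ), ?_⟩
    have hwτ := (hw' τ hτ).ne'
    push_cast
    rw [eq_div_iff (by positivity), ← hk, hN, derivative_map, eval_map, hNQ, hq,
      derivative_mul, derivative_C, derivative_expand]
    simp only [zero_mul, zero_add, map_mul, map_sub, map_one, map_pow, expand_X]
    simp [eval₂_mul, eval₂_sub, eval₂_pow]
    ring
  -- `A (X ^ 2)` divides a product of terms `q (X ^ 2) - r` with rational `r`, a statement over `ℚ` that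
  -- passes to every field.
  choose! c hc using hval
  have hdvd : expand ℚ 2 A ∣ ∏ r ∈ T.image c, (expand ℚ 2 q - C r) := by
    rw [← map_dvd_map' (algebraMap ℚ ℝ)]
    have h2 : Lagrange.nodal T (id : ℝ → ℝ) ∣
        (∏ r ∈ T.image c, (expand ℚ 2 q - C r)).map (algebraMap ℚ ℝ) := by
      rw [Lagrange.nodal]
      refine Finset.prod_dvd_of_coprime (fun σ _ τ _ hne =>
        pairwise_coprime_X_sub_C Function.injective_id hne) fun τ hτ => ?_
      rw [dvd_iff_isRoot, IsRoot.def, Polynomial.map_prod, eval_prod]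
      refine Finset.prod_eq_zero (Finset.mem_image_of_mem c hτ) ?_
      rw [Polynomial.map_sub, eval_sub, eval_map, id, hc τ hτ]
      simp
    rw [hN, Polynomial.map_mul, map_C] at h2
    exact (dvd_mul_left _ _).trans h2
  obtain ⟨x, hx⟩ := IsAlgClosed.exists_pow_nat_eq y two_pos
  have h0 : aeval x (expand ℚ 2 A) = 0 := by rw [expand_aeval, hx, hy]
  have h3 := aeval_eq_zero_of_dvd_aeval_eq_zero hdvd h0
  rw [map_prod, Finset.prod_eq_zero_iff] at h3
  obtain ⟨r, -, hr⟩ := h3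
  refine ⟨r, ?_⟩
  rw [map_sub, expand_aeval, hx, aeval_C, sub_eq_zero] at hr
  rw [hq] at hr
  simpa using hr

/-- The version of `rational_at_roots_zero` for both singular points `0` and `1`. -/
theorem rational_at_roots (hn : 1 ≤ n) (hT : T.card ≤ 2 * n) (h1 : ∀ τ ∈ T, |τ| ≤ 1)
    (hw : ∀ τ ∈ T, 0 < w τ)
    (hQ : ∀ f : ℝ[X], f.natDegree ≤ 2 * (2 * n) - 1 →
      ∑ τ ∈ T, (w τ : ℝ) * f.eval τ = momentFunctional ℝ (2 * l + 2) f)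
    {b : ℕ} (hb : b = 0 ∨ b = l)
    {K : Type*} [Field K] [CharZero K] [IsAlgClosed K] {y : K}
    (hy : aeval y (hypPoly n l b) = 0) :
    ∃ c : ℚ, y * (1 - y) * aeval y (derivative (hypPoly n l b)) ^ 2 = c := by
  rcases hb with rfl | rfl
  · exact rational_at_roots_zero hn hT h1 hw hQ hy
  · obtain ⟨a, ha, h⟩ := hypPoly_comp_one_sub_X n b
    have haK : (a : K) ≠ 0 := by exact_mod_cast ha
    have hv := congrArg (aeval y) h
    rw [aeval_comp, map_mul, hy, mul_zero] at hv
    obtain ⟨c, hc⟩ := rational_at_roots_zero hn hT h1 hw hQ hv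
    have hd := congrArg (fun f => aeval y (derivative f)) h
    simp only [derivative_comp, derivative_C_mul, map_mul, aeval_comp, aeval_C] at hd
    refine ⟨c / a ^ 2, ?_⟩
    push_cast
    rw [eq_div_iff (pow_ne_zero 2 haK), ← hc]
    simp at hd ⊢
    linear_combination (y * (1 - y)) * (aeval (1 - y) (derivative (hypPoly n b 0)) -
      a * aeval y (derivative (hypPoly n b b))) * hd

end Values

/-! ### Newton polygons over ultrametric fields -/

section Ultrametric

variable {K : Type*} [NormedField K] [IsUltrametricDist K]

theorem norm_coeff_prod_one_sub_le {M : ℝ} (hM : 0 ≤ M) (s : Multiset K)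
    (hs : ∀ u ∈ s, ‖u‖ ≤ M) (j : ℕ) :
    ‖((s.map fun u => 1 - C u * X).prod).coeff j‖ ≤ M ^ j := by
  induction s using Multiset.induction_on generalizing j with
  | empty =>
    rw [Multiset.map_zero, Multiset.prod_zero, coeff_one]
    split_ifs with h
    · simp [h]
    · simpa using pow_nonneg hM j
  | cons u s ih =>
    have ih' := ih fun v hv => hs v (Multiset.mem_cons_of_mem hv)
    rw [Multiset.map_cons, Multiset.prod_cons, sub_mul, one_mul, coeff_sub, mul_assoc, coeff_C_mul,
      sub_eq_add_neg]
    refine (IsUltrametricDist.norm_add_le_max _ _).trans (max_le (ih' j) ?_)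
    rw [norm_neg]
    rcases j with _ | j
    · simp
    · rw [coeff_X_mul, norm_mul, pow_succ, mul_comm]
      exact mul_le_mul (ih' j) (hs u (Multiset.mem_cons_self u s)) (norm_nonneg _) (by positivity)

variable [IsAlgClosed K]

/-- A polynomial with constant term `1` and a large coefficient has a small root: the coefficients are
elementary symmetric functions of the inverse roots. -/
theorem exists_root_norm_le {f : K[X]} (h0 : f.coeff 0 = 1) {e : ℕ} (he : 1 ≤ e) {P : ℝ}
    (hP : 0 < P) (hfe : ‖f.coeff e‖ = P) : ∃ y, f.eval y = 0 ∧ P * ‖y‖ ^ e ≤ 1 := by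
  by_contra! hcon
  have hf0 : f ≠ 0 := by rintro rfl; simp at h0
  have hroot : ∀ y ∈ f.roots, y ≠ 0 ∧ P * ‖y‖ ^ e > 1 := by
    intro y hy
    have hy' : f.eval y = 0 := (mem_roots hf0).1 hy
    refine ⟨?_, hcon y hy'⟩
    rintro rfl
    rw [← coeff_zero_eq_eval_zero, h0] at hy'
    exact one_ne_zero hy'
  have hfac : f = (f.roots.map fun y => 1 - C y⁻¹ * X).prod := by
    have h1 := (IsAlgClosed.splits f).eq_prod_roots
    have h2 : (f.roots.map fun y => X - C y) =
        f.roots.map fun y => C (-y) * (1 - C y⁻¹ * X) := by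
      refine Multiset.map_congr rfl fun y hy => ?_
      rw [mul_sub, mul_one, ← mul_assoc, ← C_mul, neg_mul, mul_inv_cancel₀ (hroot y hy).1]
      simp
      ring
    rw [h2, Multiset.prod_map_mul, Multiset.prod_hom' f.roots C (fun y => -y),
      ← mul_assoc, ← C_mul] at h1
    set c := f.leadingCoeff * (f.roots.map fun y => -y).prod
    have h3 := congrArg (fun g : K[X] => g.eval 0) h1
    rw [← coeff_zero_eq_eval_zero, h0] at h3
    simp only [eval_mul, eval_C, eval_multiset_prod, Multiset.map_map, Function.comp_def] at h3
    simp at h3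
    rw [← h3, C_1, one_mul] at h1
    exact h1
  by_cases hempty : f.roots = 0
  · rw [hempty, Multiset.map_zero, Multiset.prod_zero] at hfac
    rw [hfac, coeff_one, if_neg (by omega), norm_zero] at hfe
    exact hP.ne hfe
  · classical
    obtain ⟨y, hy, hmax⟩ := Finset.exists_max_image f.roots.toFinset (fun y => ‖y⁻¹‖) (by
      obtain ⟨y, hy⟩ := Multiset.exists_mem_of_ne_zero hempty
      exact ⟨y, Multiset.mem_toFinset.2 hy⟩)
    have h1 := norm_coeff_prod_one_sub_le (norm_nonneg y⁻¹) (f.roots.map fun y => y⁻¹) (by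
      intro u hu
      obtain ⟨v, hv, rfl⟩ := Multiset.mem_map.1 hu
      exact hmax v (Multiset.mem_toFinset.2 hv)) e
    rw [Multiset.map_map] at h1
    simp only [Function.comp_def] at h1
    rw [← hfac, hfe] at h1
    obtain ⟨hy0, hy1⟩ := hroot y (Multiset.mem_toFinset.1 hy)
    have hpos : 0 < ‖y‖ ^ e := pow_pos (norm_pos_iff.2 hy0) e
    have := mul_le_mul_of_nonneg_right h1 hpos.le
    rw [norm_inv, inv_pow, inv_mul_cancel₀ hpos.ne'] at this
    linarith

/-- The first edge of the Newton polygon: if it joins `(0, 0)` to the `e`-th vertex and contains no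
further vertex, there is a root `y` with `‖y‖ ^ e = P⁻¹`, at which `y * f'(y)` is dominated by
a single term. -/
theorem exists_root_norm_eq {f : K[X]} (h0 : f.coeff 0 = 1) {e : ℕ} (he : 1 ≤ e) {P : ℝ}
    (hP : 1 < P) (hfe : ‖f.coeff e‖ = P)
    (hf : ∀ j, 1 ≤ j → j ≠ e → ‖f.coeff j‖ ^ e < P ^ j) (hen : ‖(e : K)‖ = 1) :
    ∃ y, f.eval y = 0 ∧ P * ‖y‖ ^ e = 1 ∧ ‖y * (derivative f).eval y‖ = 1 := by
  obtain ⟨y, hy, hyP⟩ := exists_root_norm_le h0 he (by linarith) hfe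
  have hterm : ∀ j, 1 ≤ j → j ≠ e → ‖f.coeff j * y ^ j‖ < 1 := by
    intro j hj hje
    refine lt_of_pow_lt_pow_left₀ e zero_le_one ?_
    rw [one_pow, norm_mul, mul_pow, norm_pow]
    rcases eq_or_ne y 0 with rfl | hy0
    · rw [norm_zero, zero_pow (by omega), zero_pow (by omega), mul_zero]
      exact one_pos
    · have h1 : 0 < (‖y‖ ^ j) ^ e := by
        have := norm_pos_iff.2 hy0
        positivity
      calc ‖f.coeff j‖ ^ e * (‖y‖ ^ j) ^ e < P ^ j * (‖y‖ ^ j) ^ e :=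
            mul_lt_mul_of_pos_right (hf j hj hje) h1
        _ = (P * ‖y‖ ^ e) ^ j := by ring
        _ ≤ 1 := pow_le_one₀ (by positivity) hyP
  have hede : e ∈ Finset.range (f.natDegree + 1) := by
    rw [Finset.mem_range, Nat.lt_succ_iff]
    refine le_natDegree_of_ne_zero fun h => ?_
    rw [h, norm_zero] at hfe
    linarith
  have hy1 : P * ‖y‖ ^ e = 1 := by
    by_contra hne
    have hlt : ‖f.coeff e * y ^ e‖ < 1 := by
      rw [norm_mul, norm_pow, hfe]
      exact lt_of_le_of_ne hyP hne
    rw [eval_eq_sum_range, Finset.sum_range_succ', h0, pow_zero, mul_one] at hy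
    have h1 : ∑ k ∈ Finset.range f.natDegree, f.coeff (k + 1) * y ^ (k + 1) = -1 :=
      eq_neg_of_add_eq_zero_left hy
    have h2 : ‖∑ k ∈ Finset.range f.natDegree, f.coeff (k + 1) * y ^ (k + 1)‖ < 1 := by
      obtain ⟨k, -, hk⟩ := IsUltrametricDist.exists_norm_finsetSum_le
        (Finset.range f.natDegree) fun k => f.coeff (k + 1) * y ^ (k + 1)
      refine hk.trans_lt ?_
      rcases eq_or_ne (k + 1) e with h | h
      · rw [h]; exact hlt
      · exact hterm _ (by omega) h
    rw [h1, norm_neg, norm_one] at h2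
    exact lt_irrefl _ h2
  refine ⟨y, hy, hy1, ?_⟩
  have hder : y * (derivative f).eval y =
      ∑ k ∈ Finset.range (f.natDegree + 1), (k : K) * (f.coeff k * y ^ k) := by
    rw [derivative_eval, sum_over_range _ (by simp), Finset.mul_sum]
    refine Finset.sum_congr rfl fun k _ => ?_
    rcases k with _ | k
    · simp
    · rw [Nat.add_sub_cancel]; push_cast; ring
  rw [hder, ← Finset.add_sum_erase _ _ hede]
  have hmain : ‖(e : K) * (f.coeff e * y ^ e)‖ = 1 := by
    rw [norm_mul, norm_mul, norm_pow, hfe, hen, hy1, one_mul]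
  have hrest : ‖∑ k ∈ (Finset.range (f.natDegree + 1)).erase e, (k : K) * (f.coeff k * y ^ k)‖ < 1 := by
    obtain ⟨k, hk, hle⟩ := IsUltrametricDist.exists_norm_finsetSum_le
      ((Finset.range (f.natDegree + 1)).erase e) fun k => (k : K) * (f.coeff k * y ^ k)
    rcases Finset.eq_empty_or_nonempty ((Finset.range (f.natDegree + 1)).erase e) with hE | hE
    · rw [hE]; simp
    · refine hle.trans_lt ?_
      rcases Nat.eq_zero_or_pos k with rfl | hk1
      · simp
      · rw [norm_mul]
        calc ‖(k : K)‖ * ‖f.coeff k * y ^ k‖ ≤ 1 * ‖f.coeff k * y ^ k‖ := by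
              gcongr
              exact IsUltrametricDist.norm_natCast_le_one K k
          _ < 1 := by
              rw [one_mul]
              exact hterm k hk1 (Finset.ne_of_mem_erase (hk hE))
  rw [IsUltrametricDist.norm_add_eq_max_of_norm_ne_norm (by rw [hmain]; exact hrest.ne'), hmain,
    max_eq_left hrest.le]

end Ultrametric

/-- In an arithmetic progression of odd numbers, all but one term contribute no more factors `p`
to the product than the factorial: outside a term of maximal valuation, the valuation of each term
is bounded by that of a difference. -/
theorem factorization_prod_odd_le {p : ℕ} (hp : p.Prime) (hp2 : p ≠ 2) (b : ℕ) {j : ℕ}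
    (hj : 1 ≤ j) : ∃ i < j, (∏ i ∈ Finset.range j, (2 * b + 2 * i + 1)).factorization p ≤
      (j.factorial).factorization p + (2 * b + 2 * i + 1).factorization p := by
  obtain ⟨i, hi, hmax⟩ := Finset.exists_max_image (Finset.range j)
    (fun i => (2 * b + 2 * i + 1).factorization p) ⟨0, Finset.mem_range.2 hj⟩
  rw [Finset.mem_range] at hi
  refine ⟨i, hi, ?_⟩
  have hcop : Nat.Coprime p 2 := (Nat.coprime_primes hp Nat.prime_two).2 hp2
  have hdiff : ∀ k < j, ∀ t, t ≠ 0 → (k + t = i ∨ i + t = k) →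
      (2 * b + 2 * k + 1).factorization p ≤ t.factorization p := by
    intro k hk t ht hkt
    rw [← hp.pow_dvd_iff_le_factorization ht]
    set v := (2 * b + 2 * k + 1).factorization p with hv
    have h1 : p ^ v ∣ 2 * b + 2 * k + 1 := Nat.ordProj_dvd _ _
    have h2 : p ^ v ∣ 2 * b + 2 * i + 1 :=
      (hp.pow_dvd_iff_le_factorization (by omega)).2 (hmax k (Finset.mem_range.2 hk))
    have h3 : p ^ v ∣ 2 * t := by
      rcases hkt with h | h
      · have := Nat.dvd_sub h2 h1
        rwa [show 2 * b + 2 * i + 1 - (2 * b + 2 * k + 1) = 2 * t by omega] at this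
      · have := Nat.dvd_sub h1 h2
        rwa [show 2 * b + 2 * k + 1 - (2 * b + 2 * i + 1) = 2 * t by omega] at this
    exact (Nat.Coprime.pow_left v hcop).dvd_of_dvd_mul_left h3
  obtain ⟨r, rfl⟩ : ∃ r, j = i + 1 + r := ⟨j - (i + 1), by omega⟩
  have hfac : ∀ m, (m.factorial).factorization p =
      ∑ k ∈ Finset.range m, (k + 1).factorization p := by
    intro m
    rw [← Finset.prod_range_add_one_eq_factorial, Nat.factorization_prod (by simp)]
    simp
  have hlow : ∑ k ∈ Finset.range i, (2 * b + 2 * k + 1).factorization p ≤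
      (i.factorial).factorization p := by
    rw [hfac, ← Finset.sum_range_reflect (fun k => (k + 1).factorization p)]
    refine Finset.sum_le_sum fun k hk => ?_
    rw [Finset.mem_range] at hk
    exact hdiff k (by omega) _ (by omega) (Or.inl (by omega))
  have hhigh : ∑ k ∈ Finset.range r, (2 * b + 2 * (i + 1 + k) + 1).factorization p ≤
      (r.factorial).factorization p := by
    rw [hfac]
    refine Finset.sum_le_sum fun k hk => ?_
    rw [Finset.mem_range] at hk
    exact hdiff _ (by omega) _ (by omega) (Or.inr (by omega))
  have hdvd : i.factorial * r.factorial ∣ (i + 1 + r).factorial :=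
    (Nat.factorial_mul_factorial_dvd_factorial_add i r).trans (Nat.factorial_dvd_factorial (by omega))
  have hle := (Nat.factorization_le_iff_dvd
    (mul_ne_zero (Nat.factorial_ne_zero _) (Nat.factorial_ne_zero _))
    (Nat.factorial_ne_zero _)).2 hdvd p
  rw [Nat.factorization_mul (Nat.factorial_ne_zero _) (Nat.factorial_ne_zero _),
    Finsupp.add_apply] at hle
  rw [Nat.factorization_prod (by simp), Finsupp.finsetSum_apply, Finset.sum_range_add,
    Finset.sum_range_succ]
  omega

/-! ### The p-adic criterion -/

/-- Closed form of the coefficients of `hypPoly`. -/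
theorem hypCoeff_mul_prod (n l b j : ℕ) :
    hypCoeff n l b j * (∏ i ∈ Finset.range j, (2 * b + 2 * i + 1) : ℕ) =
      (-2) ^ j * (n.choose j : ℚ) * ((n + l).ascFactorial j : ℕ) := by
  induction j with
  | zero => simp [hypCoeff]
  | succ j ih =>
    have h1 : ((j : ℚ) + 1) ≠ 0 := by positivity
    have hch : (n.choose (j + 1) : ℚ) * (j + 1) = n.choose j * (n - j) := by
      have h := Nat.choose_succ_right_eq n j
      rcases le_or_gt j n with hle | hlt
      · have h' := congrArg (Nat.cast (R := ℚ)) h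
        push_cast [Nat.cast_sub hle] at h'
        exact h'
      · rw [Nat.choose_eq_zero_of_lt hlt, Nat.choose_eq_zero_of_lt (by omega)]
        simp
    have hs := hypCoeff_succ n l b j
    rw [Finset.prod_range_succ, Nat.ascFactorial_succ]
    apply mul_left_cancel₀ h1
    push_cast at ih ⊢
    linear_combination (∏ i ∈ Finset.range j, (2 * (b : ℚ) + 2 * i + 1)) * hs -
      2 * ((n : ℚ) - j) * (n + l + j) * ih -
      (-2) ^ (j + 1) * ((n + l).ascFactorial j : ℚ) * (n + l + j) * hch

theorem norm_natCast_eq_zpow {p : ℕ} [Fact p.Prime] {N : ℕ} (hN : N ≠ 0) :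
    ‖(N : ℚ_[p])‖ = (p : ℝ) ^ (-(N.factorization p : ℤ)) := by
  have h := Padic.eq_padicNorm (p := p) (N : ℚ)
  rw [padicNorm.eq_zpow_of_nonzero (by exact_mod_cast hN), padicValRat.of_nat,
    ← Nat.factorization_def _ Fact.out, Rat.cast_natCast] at h
  rw [h]
  push_cast
  rfl

theorem norm_ratCast_padicAlgCl {p : ℕ} [Fact p.Prime] (q : ℚ) :
    ‖(q : PadicAlgCl p)‖ = ‖(q : ℚ_[p])‖ := by
  rw [← PadicAlgCl.norm_extends]
  simp

theorem norm_hypCoeff {p : ℕ} [Fact p.Prime] (hp2 : p ≠ 2) {n l b j : ℕ} (hj : j ≤ n)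
    (hl : 1 ≤ n + l) :
    ‖(hypCoeff n l b j : ℚ_[p])‖ =
      (p : ℝ) ^ (((∏ i ∈ Finset.range j, (2 * b + 2 * i + 1)).factorization p : ℤ) -
        (n.choose j * (n + l).ascFactorial j).factorization p) := by
  have hp : p.Prime := Fact.out
  have hp0 : (p : ℝ) ≠ 0 := by exact_mod_cast hp.ne_zero
  have hD : (∏ i ∈ Finset.range j, (2 * b + 2 * i + 1)) ≠ 0 := by simp [Finset.prod_eq_zero_iff]
  have hA : n.choose j * (n + l).ascFactorial j ≠ 0 := by
    refine mul_ne_zero (Nat.choose_pos hj).ne' ?_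
    obtain ⟨c, hc⟩ : ∃ c, n + l = c + 1 := ⟨n + l - 1, by omega⟩
    rw [hc]
    exact (Nat.ascFactorial_pos c j).ne'
  have h := congrArg (fun q : ℚ => ‖(q : ℚ_[p])‖) (hypCoeff_mul_prod n l b j)
  simp only [mul_assoc] at h
  rw [← Nat.cast_mul] at h
  simp only [Rat.cast_mul, Rat.cast_natCast, Rat.cast_pow, Rat.cast_neg, Rat.cast_ofNat] at h
  rw [norm_mul, norm_mul, norm_pow, norm_neg, norm_natCast_eq_zpow hD, norm_natCast_eq_zpow hA] at h
  have h2 : ‖(2 : ℚ_[p])‖ = 1 := by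
    have : ‖((2 : ℕ) : ℚ_[p])‖ = 1 := by
      rw [Padic.norm_natCast_eq_one_iff]
      exact (Nat.coprime_primes hp Nat.prime_two).2 hp2
    exact_mod_cast this
  rw [h2, one_pow, one_mul] at h
  rw [sub_eq_add_neg, zpow_add₀ hp0, ← h, mul_comm, mul_assoc, ← zpow_add₀ hp0]
  simp

/-- The `p`-adic criterion. If the first edge of the `p`-adic Newton polygon of `hypPoly n l b` has
slope `-1 / e` with `2 ≤ e` prime to `p`, then `y (1 - y) A'(y) ^ 2` has valuation `-1 / e` at the
corresponding roots, which is not an integer. -/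
theorem exists_root_not_rational_of_norm {p : ℕ} [Fact p.Prime] {n l b e : ℕ} (he : 2 ≤ e)
    (hpe : ¬ p ∣ e) (hfe : ‖(hypCoeff n l b e : ℚ_[p])‖ = p)
    (hfj : ∀ j, 1 ≤ j → j ≠ e → ‖(hypCoeff n l b j : ℚ_[p])‖ ^ e < (p : ℝ) ^ j) :
    ∃ y : PadicAlgCl p, aeval y (hypPoly n l b) = 0 ∧
      ¬ ∃ c : ℚ, y * (1 - y) * aeval y (derivative (hypPoly n l b)) ^ 2 = c := by
  have hp : p.Prime := Fact.out
  have hp1 : (1 : ℝ) < p := by exact_mod_cast hp.one_lt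
  set f : (PadicAlgCl p)[X] := (hypPoly n l b).map (algebraMap ℚ (PadicAlgCl p)) with hf
  have hcoeff : ∀ j, ‖f.coeff j‖ = ‖(hypCoeff n l b j : ℚ_[p])‖ := by
    intro j
    rw [hf, coeff_map, coeff_hypPoly, eq_ratCast, norm_ratCast_padicAlgCl]
  simp only [← hcoeff] at hfe hfj
  have hnorm_e : ‖(e : PadicAlgCl p)‖ = 1 := by
    have h1 := norm_ratCast_padicAlgCl (p := p) (e : ℚ)
    rw [Rat.cast_natCast, Rat.cast_natCast] at h1
    rw [h1, Padic.norm_natCast_eq_one_iff, hp.coprime_iff_not_dvd]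
    exact hpe
  have h0 : f.coeff 0 = 1 := by
    rw [hf, coeff_map, coeff_hypPoly]
    simp [hypCoeff]
  obtain ⟨y, hy, hyP, hder⟩ := exists_root_norm_eq h0 (by omega) hp1 hfe hfj hnorm_e
  refine ⟨y, by rwa [hf, eval_map_algebraMap] at hy, ?_⟩
  rintro ⟨c, hc⟩
  have hder' : aeval y (derivative (hypPoly n l b)) = (derivative f).eval y := by
    rw [hf, derivative_map, eval_map_algebraMap]
  rw [hder'] at hc
  have hp0 : (0 : ℝ) < p := by linarith
  have hy0 : 0 < ‖y‖ := by
    rw [norm_pos_iff]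
    rintro rfl
    rw [norm_zero, zero_pow (by omega), mul_zero] at hyP
    exact zero_ne_one hyP
  have hy1 : ‖y‖ < 1 := by
    by_contra! h
    have := one_le_pow₀ h (n := e)
    nlinarith
  have h1y : ‖1 - y‖ = 1 := by
    rw [sub_eq_add_neg, IsUltrametricDist.norm_add_eq_max_of_norm_ne_norm
      (by rw [norm_one, norm_neg]; exact hy1.ne'), norm_one, norm_neg, max_eq_left hy1.le]
  have hcn : ‖y‖ * ‖(c : ℚ_[p])‖ = 1 := by
    rw [← norm_ratCast_padicAlgCl, ← hc, ← norm_mul,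
      show y * (y * (1 - y) * (derivative f).eval y ^ 2) =
        (1 - y) * (y * (derivative f).eval y) ^ 2 by ring, norm_mul, norm_pow, hder, h1y]
    norm_num
  have hc0 : c ≠ 0 := by
    rintro rfl
    simp at hcn
  obtain ⟨z, hz⟩ := padicNorm.values_discrete (p := p) hc0
  have hcz : ‖(c : ℚ_[p])‖ = (p : ℝ) ^ (-z) := by
    rw [Padic.eq_padicNorm, hz]
    push_cast
    rfl
  rw [hcz] at hcn
  -- Now `p ^ (-z * e) = p`, which is impossible for `e ≥ 2`.
  have hfin : (p : ℝ) ^ (-z * e) = (p : ℝ) ^ (1 : ℤ) := by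
    rw [zpow_mul, zpow_natCast, zpow_one]
    calc ((p : ℝ) ^ (-z)) ^ e = (p * ‖y‖ ^ e) * ((p : ℝ) ^ (-z)) ^ e := by
          rw [hyP, one_mul]
      _ = p * (‖y‖ * (p : ℝ) ^ (-z)) ^ e := by ring
      _ = p := by rw [hcn, one_pow, mul_one]
  have hz1 := zpow_right_injective₀ hp0 hp1.ne' hfin
  have := Int.eq_one_or_neg_one_of_mul_eq_one' hz1
  omega

/-- Divisibility conditions that imply the hypotheses of `exists_root_not_rational_of_norm`. -/
theorem exists_root_not_rational {p : ℕ} [Fact p.Prime] (hp2 : p ≠ 2) {n l b e : ℕ} (he : 2 ≤ e)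
    (hen : e ≤ n) (hpe : p ∣ 2 * b + 2 * e - 1) (hpe2 : ¬ p ^ 2 ∣ 2 * b + 2 * e - 1)
    (hH : ∀ i < n, i + 1 ≠ e → ∀ k, 1 ≤ k → p ^ k ∣ 2 * b + 2 * i + 1 → k * e < i + 1)
    (hnum : ¬ p ∣ n.choose e * (n + l).ascFactorial e) :
    ∃ y : PadicAlgCl p, aeval y (hypPoly n l b) = 0 ∧
      ¬ ∃ c : ℚ, y * (1 - y) * aeval y (derivative (hypPoly n l b)) ^ 2 = c := by
  have hp : p.Prime := Fact.out
  have hp1 : (1 : ℝ) < p := by exact_mod_cast hp.one_lt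
  have hl : 1 ≤ n + l := by omega
  obtain ⟨i₀, rfl⟩ : ∃ i₀, e = i₀ + 1 := ⟨e - 1, by omega⟩
  rw [show 2 * b + 2 * (i₀ + 1) - 1 = 2 * b + 2 * i₀ + 1 by omega] at hpe hpe2
  have hv0 : (2 * b + 2 * i₀ + 1).factorization p = 1 := by
    have h1 := (hp.dvd_iff_one_le_factorization (by omega)).1 hpe
    have h2 := mt (hp.pow_dvd_iff_le_factorization (by omega)).2 hpe2
    omega
  have hfe : ‖(hypCoeff n l b (i₀ + 1) : ℚ_[p])‖ = p := by
    rw [norm_hypCoeff hp2 hen hl, Nat.factorization_eq_zero_of_not_dvd hnum,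
      Finset.prod_range_succ, Nat.factorization_mul (by simp [Finset.prod_eq_zero_iff]) (by omega),
      Finsupp.add_apply, hv0, Nat.factorization_eq_zero_of_not_dvd]
    · simp
    · rw [hp.prime.dvd_finsetProd_iff]
      rintro ⟨i, hi, hdvd⟩
      rw [Finset.mem_range] at hi
      have := hH i (by omega) (by omega) 1 le_rfl (by rwa [pow_one])
      omega
  have hfj : ∀ j, 1 ≤ j → j ≠ i₀ + 1 → ‖(hypCoeff n l b j : ℚ_[p])‖ ^ (i₀ + 1) < (p : ℝ) ^ j := by
    intro j hj hje
    rcases lt_or_ge n j with hlt | hjn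
    · rw [hypCoeff_eq_zero hlt, Rat.cast_zero, norm_zero, zero_pow (by omega)]
      positivity
    · obtain ⟨i, hij, hle⟩ := factorization_prod_odd_le hp hp2 b hj
      set v := (2 * b + 2 * i + 1).factorization p with hv
      have hfac : (j.factorial).factorization p ≤
          (n.choose j * (n + l).ascFactorial j).factorization p := by
        have hdvd : j.factorial ∣ n.choose j * (n + l).ascFactorial j :=
          (Nat.factorial_dvd_ascFactorial _ _).mul_left _
        have hne : n.choose j * (n + l).ascFactorial j ≠ 0 := by
          refine mul_ne_zero (Nat.choose_pos hjn).ne' ?_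
          obtain ⟨c, hc⟩ : ∃ c, n + l = c + 1 := ⟨n + l - 1, by omega⟩
          rw [hc]
          exact (Nat.ascFactorial_pos c j).ne'
        exact (Nat.factorization_le_iff_dvd (Nat.factorial_ne_zero _) hne).2 hdvd p
      have hvlt : v * (i₀ + 1) < j := by
        rcases Nat.eq_zero_or_pos v with h0 | hpos
        · rw [h0]; omega
        · by_cases hie : i = i₀
          · rw [hv, hie, hv0]; omega
          · have := hH i (by omega) (by omega) v hpos (Nat.ordProj_dvd _ _)
            omega
      have hb : ‖(hypCoeff n l b j : ℚ_[p])‖ ≤ (p : ℝ) ^ v := by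
        rw [norm_hypCoeff hp2 hjn hl, ← zpow_natCast]
        exact zpow_le_zpow_right₀ hp1.le (by omega)
      calc _ ≤ ((p : ℝ) ^ v) ^ (i₀ + 1) := by gcongr
        _ = (p : ℝ) ^ (v * (i₀ + 1)) := (pow_mul _ _ _).symm
        _ < (p : ℝ) ^ j := pow_lt_pow_right₀ hp1 hvlt
  refine exists_root_not_rational_of_norm he (fun hdvd => hnum ?_) hfe hfj
  exact (hdvd.trans ((Nat.dvd_factorial (by omega) le_rfl).trans
    (Nat.factorial_dvd_ascFactorial _ _))).mul_left _

/-! ### Choice of the prime -/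

/-- The rationality property of the polynomials `A = hypPoly n l 0` and `A = hypPoly n l l` forced by
a stiff configuration: `y (1 - y) A'(y) ^ 2` is rational at every root `y` of `A`, in every
algebraically closed field of characteristic zero. -/
def RationalAtRoots (n l : ℕ) : Prop :=
  ∀ b : ℕ, b = 0 ∨ b = l → ∀ (K : Type) [Field K] [CharZero K] [IsAlgClosed K] (y : K),
    aeval y (hypPoly n l b) = 0 →
      ∃ c : ℚ, y * (1 - y) * aeval y (derivative (hypPoly n l b)) ^ 2 = c

theorem not_dvd_choose_mul_ascFactorial {p n l e : ℕ} (hp : p.Prime)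
    (h1 : ∀ k < e, ¬ p ∣ n - k) (h2 : ∀ k < e, ¬ p ∣ n + l + k) :
    ¬ p ∣ n.choose e * (n + l).ascFactorial e := by
  rw [hp.dvd_mul, not_or]
  constructor
  · intro h
    have h3 : p ∣ n.descFactorial e := by
      rw [Nat.descFactorial_eq_factorial_mul_choose]
      exact h.mul_left _
    rw [Nat.descFactorial_eq_prod_range, hp.prime.dvd_finsetProd_iff] at h3
    obtain ⟨k, hk, hd⟩ := h3
    exact h1 k (Finset.mem_range.1 hk) hd
  · rw [Nat.ascFactorial_eq_prod_range, hp.prime.dvd_finsetProd_iff]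
    rintro ⟨k, hk, hd⟩
    exact h2 k (Finset.mem_range.1 hk) hd

theorem mul_add_one_le_pow {p : ℕ} (hp : 3 ≤ p) {k : ℕ} (hk : 2 ≤ k) : k * (p + 1) ≤ p ^ k := by
  induction k, hk using Nat.le_induction with
  | base => nlinarith
  | succ k hk ih =>
    have h : k + 1 ≤ k * p := by nlinarith
    calc (k + 1) * (p + 1) ≤ k * p * (p + 1) := Nat.mul_le_mul_right _ h
      _ = k * (p + 1) * p := by ring
      _ ≤ p ^ k * p := Nat.mul_le_mul_right p ih
      _ = p ^ (k + 1) := (pow_succ p k).symm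

/-- The `p`-adic criterion for the prime `p = 2 * b + 2 * e - 1`. -/
theorem not_rationalAtRoots_of_eq {p n l b e : ℕ} (hp : p.Prime) (hb : b = 0 ∨ b = l)
    (he : 2 ≤ e) (hpe : p = 2 * b + 2 * e - 1) (hen : e ≤ n)
    (hnum : ¬ p ∣ n.choose e * (n + l).ascFactorial e) : ¬ RationalAtRoots n l := by
  intro hR
  have : Fact p.Prime := ⟨hp⟩
  have hp3 : 3 ≤ p := by omega
  obtain ⟨y, hy, hc⟩ := exists_root_not_rational (p := p) (n := n) (l := l) (b := b) (e := e)
    (by omega) he hen (by rw [← hpe]) (by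
      rw [← hpe]
      intro h
      have := Nat.le_of_dvd (by omega) h
      nlinarith) (by
      intro i _ hie k hk hdvd
      have hle := Nat.le_of_dvd (by omega) hdvd
      rcases Nat.lt_or_ge k 2 with hk1 | hk2
      · obtain rfl : k = 1 := by omega
        rw [pow_one] at hle
        omega
      · have h1 := mul_add_one_le_pow hp3 hk2
        have h2 : k * (p + 1) = k * (2 * b) + 2 * (k * e) := by
          rw [hpe, show 2 * b + 2 * e - 1 + 1 = 2 * b + 2 * e by omega]; ring
        have h3 : 2 * (2 * b) ≤ k * (2 * b) := Nat.mul_le_mul_right _ hk2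
        omega) hnum
  exact hc (hR b hb _ y hy)

/-- A prime `p ≥ 2 * l + 3` dividing one of `2 * n + 1, ..., 2 * n + 2 * l - 1` contradicts
rationality: the even multiples of `p` are used at the singular point `0`, the odd ones at `1`. -/
theorem not_rationalAtRoots_of_prime_dvd {p n l i : ℕ} (hp : p.Prime) (hpl : 2 * l + 3 ≤ p)
    (hi : 1 ≤ i) (hil : i ≤ 2 * l - 1) (hdvd : p ∣ 2 * n + i) : ¬ RationalAtRoots n l := by
  obtain ⟨q, hq⟩ : ∃ q, p = 2 * q + 1 := by
    rcases hp.eq_two_or_odd' with h | ⟨q, hq⟩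
    · omega
    · exact ⟨q, hq⟩
  have hno : ∀ x t, p * t < x → x < p * (t + 1) → ¬ p ∣ x := by
    rintro x t h1 h2 ⟨s, rfl⟩
    have h3 := Nat.lt_of_mul_lt_mul_left h1
    have h4 := Nat.lt_of_mul_lt_mul_left h2
    omega
  rcases Nat.even_or_odd' i with ⟨r, rfl | rfl⟩
  · have hd : p ∣ n + r := by
      have h2 : p ∣ 2 * (n + r) := by rwa [mul_add]
      exact ((Nat.coprime_primes hp Nat.prime_two).2 (by omega)).dvd_of_dvd_mul_left h2
    obtain ⟨t, ht⟩ := hd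
    obtain ⟨s, rfl⟩ : ∃ s, t = s + 1 := ⟨t - 1, by
      rcases t with _ | t
      · omega
      · omega⟩
    have h1 : p * (s + 1) = p * s + p := by ring
    have h2 : p * (s + 1 + 1) = p * s + p + p := by ring
    -- Here `n ≡ -r` and `n + l ≡ l - r` modulo `p = 2 * q + 1`, with `1 ≤ r < l ≤ q`, so neither the
    -- `q + 1` numbers downwards from `n` nor those upwards from `n + l` meet a multiple of `p`.
    refine not_rationalAtRoots_of_eq hp (b := 0) (e := q + 1) (Or.inl rfl) (by omega) (by omega)
      (by omega) (not_dvd_choose_mul_ascFactorial hp (fun k hk => ?_) fun k hk => ?_)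
    · exact hno _ s (by omega) (by omega)
    · exact hno _ (s + 1) (by omega) (by omega)
  · obtain ⟨t, ht⟩ := hdvd
    -- `t` is odd, as `2 * n + i` is.
    obtain ⟨s, rfl | rfl⟩ := Nat.even_or_odd' t
    · have : p * (2 * s) = 2 * (p * s) := by ring
      omega
    have h1 : p * (2 * s + 1) = 2 * (p * s) + p := by ring
    have h2 : p * (s + 1) = p * s + p := by ring
    -- Here `n ≡ q - r` and `n + l ≡ q - r + l` modulo `p = 2 * q + 1`, with `0 ≤ r < l`, and again
    -- no multiple of `p` is met in `q + 1 - l` steps.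
    refine not_rationalAtRoots_of_eq hp (b := l) (e := q + 1 - l) (Or.inr rfl) (by omega) (by omega)
      (by omega) (not_dvd_choose_mul_ascFactorial hp (fun k hk => ?_) fun k hk => ?_)
    · exact hno _ s (by omega) (by omega)
    · exact hno _ s (by omega) (by omega)

/-- The criterion for a prime whose square divides none of the denominators. -/
theorem not_rationalAtRoots_of_squarefree {p n l b e : ℕ} (hp : p.Prime) (hb : b = 0 ∨ b = l)
    (hp2 : p ≠ 2) (he : 2 ≤ e) (hen : e ≤ n) (hpe : p ∣ 2 * b + 2 * e - 1)
    (hsq : ∀ i < n, ¬ p ^ 2 ∣ 2 * b + 2 * i + 1) (hlow : ∀ i < e - 1, ¬ p ∣ 2 * b + 2 * i + 1)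
    (hnum : ¬ p ∣ n.choose e * (n + l).ascFactorial e) : ¬ RationalAtRoots n l := by
  intro hR
  have : Fact p.Prime := ⟨hp⟩
  obtain ⟨y, hy, hc⟩ := exists_root_not_rational (p := p) (n := n) (l := l) (b := b) (e := e)
    hp2 he hen hpe (by
      have := hsq (e - 1) (by omega)
      rwa [show 2 * b + 2 * (e - 1) + 1 = 2 * b + 2 * e - 1 by omega] at this) (by
      intro i hi hie k hk hdvd
      rcases Nat.lt_or_ge k 2 with hk1 | hk2
      · obtain rfl : k = 1 := by omega
        rw [pow_one] at hdvd
        have : ¬ i < e - 1 := fun h => hlow i h hdvd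
        omega
      · exact absurd ((pow_dvd_pow p hk2).trans hdvd) (hsq i hi)) hnum
  exact hc (hR b hb _ y hy)

/-- For `n = 3`, `l = 11` the denominator `25` occurs, but one factor `5` cancels. -/
theorem not_rationalAtRoots_three_eleven : ¬ RationalAtRoots 3 11 := by
  intro hR
  have : Fact (Nat.Prime 5) := ⟨by norm_num⟩
  have hu : ∀ m : ℕ, ¬ 5 ∣ m → ‖(m : ℚ_[5])‖ = 1 := fun m hm =>
    Padic.norm_natCast_eq_one_iff.2 ((Nat.Prime.coprime_iff_not_dvd (by norm_num)).2 hm)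
  have h5 : ‖(5 : ℚ_[5])‖ = 5⁻¹ := by
    have := Padic.norm_p (p := 5)
    exact_mod_cast this
  have e1 : ‖(hypCoeff 3 11 11 1 : ℚ_[5])‖ = 1 := by
    have : hypCoeff 3 11 11 1 = -((84 : ℕ) : ℚ) / (23 : ℕ) := by norm_num [hypCoeff]
    rw [this]
    have h1 := hu 84 (by norm_num)
    have h2 := hu 23 (by norm_num)
    push_cast at h1 h2 ⊢
    rw [norm_div, norm_neg, h1, h2, div_one]
  have e2 : ‖(hypCoeff 3 11 11 2 : ℚ_[5])‖ = 5 := by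
    have : hypCoeff 3 11 11 2 = ((504 : ℕ) : ℚ) / ((23 : ℕ) * 5) := by norm_num [hypCoeff]
    rw [this]
    have h1 := hu 504 (by norm_num)
    have h2 := hu 23 (by norm_num)
    push_cast at h1 h2 ⊢
    rw [norm_div, norm_mul, h1, h2, h5]
    norm_num
  have e3 : ‖(hypCoeff 3 11 11 3 : ℚ_[5])‖ = 5 := by
    have : hypCoeff 3 11 11 3 = -((1792 : ℕ) : ℚ) / ((207 : ℕ) * 5) := by norm_num [hypCoeff]
    rw [this]
    have h1 := hu 1792 (by norm_num)
    have h2 := hu 207 (by norm_num)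
    push_cast at h1 h2 ⊢
    rw [norm_div, norm_neg, norm_mul, h1, h2, h5]
    norm_num
  obtain ⟨y, hy, hc⟩ := exists_root_not_rational_of_norm (p := 5) (n := 3) (l := 11) (b := 11)
    (e := 2) le_rfl (by norm_num) (by rw [e2]; norm_num) (by
      intro j hj hje
      rcases Nat.lt_or_ge 3 j with h | h
      · rw [hypCoeff_eq_zero h]
        simp
      · interval_cases j
        · rw [e1]; norm_num
        · exact absurd rfl hje
        · rw [e3]; norm_num)
  exact hc (hR 11 (Or.inr rfl) _ y hy)

/-! ### The case `n = 2`, and runs of smooth numbers -/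

theorem three_mul_not_isSquare (l : ℕ) : ¬ IsSquare (3 * ((l + 2) * (2 * l + 3))) := by
  rintro ⟨k, hk⟩
  have h3 : 3 ∣ k := by
    have : 3 ∣ k * k := ⟨_, hk.symm⟩
    rcases Nat.prime_three.dvd_mul.1 this with h | h <;> exact h
  obtain ⟨j, rfl⟩ := h3
  have hk2 : (l + 2) * (2 * l + 3) = 3 * j ^ 2 := by nlinarith
  have h3' : 3 ∣ (l + 2) * (2 * l + 3) := ⟨_, hk2⟩
  have hsq : ∀ a : ℤ, a ^ 2 % 3 ≠ 2 := by
    intro a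
    rcases (by omega : a % 3 = 0 ∨ a % 3 = 1 ∨ a % 3 = 2) with h | h | h <;>
      simp [pow_two, Int.mul_emod, h]
  rcases Nat.prime_three.dvd_mul.1 h3' with h | h
  · obtain ⟨u, hu⟩ := h
    have hc : IsCoprime (2 * (l : ℤ) + 3) u := ⟨-1, 6, by
      have : (l : ℤ) + 2 = 3 * u := by exact_mod_cast hu
      linarith⟩
    have he : (2 * (l : ℤ) + 3) * u = (j : ℤ) ^ 2 := by
      rw [hu] at hk2
      have : (3 * u * (2 * l + 3) : ℤ) = 3 * j ^ 2 := by exact_mod_cast hk2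
      linarith
    obtain ⟨a, ha | ha⟩ := Int.sq_of_gcd_eq_one (Int.isCoprime_iff_gcd_eq_one.1 hc) he
    · have := hsq a
      omega
    · nlinarith [sq_nonneg a]
  · obtain ⟨u, hu⟩ := h
    have hc : IsCoprime ((l : ℤ) + 2) u := ⟨2, -3, by
      have : 2 * (l : ℤ) + 3 = 3 * u := by exact_mod_cast hu
      linarith⟩
    have he : ((l : ℤ) + 2) * u = (j : ℤ) ^ 2 := by
      rw [hu] at hk2
      have : ((l + 2) * (3 * u) : ℤ) = 3 * j ^ 2 := by exact_mod_cast hk2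
      linarith
    obtain ⟨a, ha | ha⟩ := Int.sq_of_gcd_eq_one (Int.isCoprime_iff_gcd_eq_one.1 hc) he
    · have := hsq a
      omega
    · nlinarith [sq_nonneg a]

/-- For `n = 2`, rationality of `y (1 - y) A'(y) ^ 2` forces the roots of the quadratic polynomial `A`
to be rational, but its discriminant is not a square. -/
theorem not_rationalAtRoots_two {l : ℕ} (hl : 1 ≤ l) : ¬ RationalAtRoots 2 l := by
  intro hR
  have hpoly : hypPoly 2 l 0 = C 1 + C (-(4 * (l + 2)) : ℚ) * X + C ((4 * (l + 2) * (l + 3) / 3 : ℚ)) * X ^ 2 := by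
    ext j
    rw [coeff_hypPoly]
    rcases j with _ | _ | _ | j
    · simp [hypCoeff]
    · simp [hypCoeff, coeff_one]; ring
    · simp [hypCoeff, coeff_one]; ring
    · rw [hypCoeff_eq_zero (by omega)]
      simp [coeff_one]
  obtain ⟨y, hy⟩ := IsAlgClosed.exists_aeval_eq_zero ℂ (hypPoly 2 l 0) (by
    intro h
    have h1 : (hypPoly 2 l 0).natDegree = 0 := natDegree_eq_of_degree_eq_some h
    have h2 := coeff_eq_zero_of_natDegree_lt (p := hypPoly 2 l 0) (n := 2) (by omega)
    rw [coeff_hypPoly] at h2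
    have : hypCoeff 2 l 0 2 = 4 * (l + 2) * (l + 3) / 3 := by simp [hypCoeff]; ring
    rw [this] at h2
    have : (0 : ℚ) < 4 * (l + 2) * (l + 3) / 3 := by positivity
    linarith)
  obtain ⟨c, hc⟩ := hR 0 (Or.inl rfl) ℂ y hy
  rw [hpoly] at hy hc
  simp only [derivative_add, derivative_C, derivative_C_mul, derivative_X, derivative_X_pow] at hc
  simp at hy hc
  have hlq : (1 : ℚ) ≤ l := by exact_mod_cast hl
  -- On the roots, `A' ^ 2` is the discriminant and `y (1 - y)` is a linear function of `y`.
  have hder : (-((4 : ℂ) * (l + 2)) + 4 * (l + 2) * (l + 3) / 3 * (2 * y)) ^ 2 =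
      16 / 3 * ((l + 2) * (2 * l + 3)) := by
    linear_combination (16 * ((l : ℂ) + 2) * (l + 3) / 3) * hy
  have hyq : ∃ r : ℚ, y = r := by
    refine ⟨((4 * (l + 2) * (l + 3) / 3) * c / (16 / 3 * ((l + 2) * (2 * l + 3))) - 1) /
      (4 / 3 * (l + 2) * l), ?_⟩
    have h1 : (4 / 3 * ((l : ℂ) + 2) * l) ≠ 0 := by
      have : ((4 / 3 * ((l : ℚ) + 2) * l : ℚ) : ℂ) ≠ 0 := by
        rw [Rat.cast_ne_zero]; positivity
      push_cast at this
      exact this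
    have h2 : (16 / 3 * (((l : ℂ) + 2) * (2 * l + 3))) ≠ 0 := by
      have : ((16 / 3 * (((l : ℚ) + 2) * (2 * l + 3)) : ℚ) : ℂ) ≠ 0 := by
        rw [Rat.cast_ne_zero]; positivity
      push_cast at this
      exact this
    push_cast
    rw [eq_div_iff h1, eq_sub_iff_add_eq, eq_div_iff h2, ← hc, ← hder]
    linear_combination (-(4 * ((l : ℂ) + 2)) + 4 * (l + 2) * (l + 3) / 3 * (2 * y)) ^ 2 * hy
  obtain ⟨r, rfl⟩ := hyq
  have hsq : IsSquare ((3 * ((l + 2) * (2 * l + 3)) : ℕ) : ℚ) := by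
    refine ⟨3 / 4 * (-(4 * ((l : ℚ) + 2)) + 4 * (l + 2) * (l + 3) / 3 * (2 * r)), ?_⟩
    have : (-((4 : ℚ) * (l + 2)) + 4 * (l + 2) * (l + 3) / 3 * (2 * r)) ^ 2 =
      16 / 3 * ((l + 2) * (2 * l + 3)) := by
      apply Rat.cast_injective (α := ℂ)
      push_cast
      exact hder
    push_cast
    linear_combination (-9 / 16 : ℚ) * this
  exact three_mul_not_isSquare l (Rat.isSquare_natCast_iff.1 hsq)

/-- If the `K` numbers following `m` have no prime factor `≥ L`, then
`(m + 1) ^ K ≤ K! * (m + K) ^ π`, where `π` is the number of primes below `L`. -/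
theorem pow_le_of_smooth {m K L : ℕ} (hK : 1 ≤ K)
    (h : ∀ i, 1 ≤ i → i ≤ K → ∀ p, p.Prime → p ∣ m + i → p < L) :
    (m + 1) ^ K ≤ K.factorial * (m + K) ^ ((Finset.range L).filter Nat.Prime).card := by
  have h1 : (m + 1) ^ K ≤ K.factorial * (m + K).choose K := by
    rw [← Nat.ascFactorial_eq_factorial_mul_choose]
    exact Nat.pow_succ_le_ascFactorial (m + 1) K
  refine h1.trans (Nat.mul_le_mul_left _ ?_)
  rw [← Nat.prod_pow_factorization_choose (m + K) K (by omega)]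
  have hsub : ∏ p ∈ Finset.range (m + K + 1), p ^ ((m + K).choose K).factorization p ≤
      ∏ p ∈ (Finset.range L).filter Nat.Prime, p ^ ((m + K).choose K).factorization p := by
    refine le_of_eq (Finset.prod_congr_of_eq_on_inter ?_ ?_ fun _ _ _ => rfl)
    · intro p _ hpL
      by_cases hp : p.Prime
      · rw [Nat.factorization_eq_zero_of_not_dvd, pow_zero]
        intro hdvd
        have h3 : p ∣ (m + 1).ascFactorial K := by
          rw [Nat.ascFactorial_eq_factorial_mul_choose]
          exact hdvd.mul_left _
        rw [Nat.ascFactorial_eq_prod_range, hp.prime.dvd_finsetProd_iff] at h3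
        obtain ⟨i, hi, hd⟩ := h3
        rw [Finset.mem_range] at hi
        have := h (i + 1) (by omega) (by omega) p hp (by rwa [show m + (i + 1) = m + 1 + i by ring])
        exact hpL (Finset.mem_filter.2 ⟨Finset.mem_range.2 this, hp⟩)
      · rw [Nat.factorization_eq_zero_of_not_prime _ hp, pow_zero]
    · intro p _ hpN
      rw [Nat.factorization_choose_eq_zero_of_lt, pow_zero]
      rw [Finset.mem_range] at hpN
      omega
  refine hsub.trans ((Finset.prod_le_pow_card _ _ (m + K) fun p _ => ?_))
  exact Nat.pow_factorization_choose_le (by omega)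

/-- The explicit bound `m + 1 < T`, obtained from `pow_le_of_smooth`. -/
theorem lt_of_smooth {m K L T : ℕ} (hK : 1 ≤ K)
    (h : ∀ i, 1 ≤ i → i ≤ K → ∀ p, p.Prime → p ∣ m + i → p < L)
    (hL : ((Finset.range L).filter Nat.Prime).card ≤ K) (hT0 : 1 ≤ T)
    (hT : K.factorial * (T + K - 1) ^ ((Finset.range L).filter Nat.Prime).card < T ^ K) :
    m + 1 < T := by
  by_contra! hle
  have h1 := pow_le_of_smooth hK h
  set π := ((Finset.range L).filter Nat.Prime).card
  obtain ⟨r, hr⟩ : ∃ r, K = π + r := ⟨K - π, by omega⟩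
  have h2 : (m + K) * T ≤ (m + 1) * (T + K - 1) := by
    obtain ⟨s, rfl⟩ : ∃ s, K = s + 1 := ⟨K - 1, by omega⟩
    rw [show T + (s + 1) - 1 = T + s by omega]
    nlinarith
  have h3 : (m + 1) ^ π * ((m + 1) ^ r * T ^ π) ≤
      (m + 1) ^ π * (K.factorial * (T + K - 1) ^ π) := by
    calc (m + 1) ^ π * ((m + 1) ^ r * T ^ π) = (m + 1) ^ K * T ^ π := by
          rw [hr, pow_add]; ring
      _ ≤ K.factorial * (m + K) ^ π * T ^ π := Nat.mul_le_mul_right _ h1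
      _ = K.factorial * ((m + K) * T) ^ π := by rw [mul_pow]; ring
      _ ≤ K.factorial * ((m + 1) * (T + K - 1)) ^ π := by gcongr
      _ = _ := by rw [mul_pow]; ring
  have h4 := Nat.le_of_mul_le_mul_left h3 (by positivity)
  have h5 : T ^ K ≤ (m + 1) ^ r * T ^ π := by
    rw [hr, pow_add, mul_comm]
    gcongr
  omega

/-! ### Finite check and conclusion -/

/-- The primes from `11` to `317`. The least prime needed is at least `2 * 3 + 3 = 9`, and
`2 * n + 2 * l - 1 ≤ 315` in the range of the finite check. -/
def primeList : List ℕ :=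
  [11, 13, 17, 19, 23, 29, 31, 37, 41, 43, 47, 53, 59, 61, 67, 71, 73, 79, 83, 89, 97, 101, 103,
    107, 109, 113, 127, 131, 137, 139, 149, 151, 157, 163, 167, 173, 179, 181, 191, 193, 197, 199,
    211, 223, 227, 229, 233, 239, 241, 251, 257, 263, 269, 271, 277, 281, 283, 293, 307, 311, 313,
    317]

/-- The parameters `(l, n, b, p, e)` for which `not_rationalAtRoots_of_squarefree` is used. -/
def exceptionalList : List (ℕ × ℕ × ℕ × ℕ × ℕ) :=
  [(15, 3, 15, 7, 3), (23, 3, 0, 5, 3), (26, 3, 26, 11, 2), (30, 3, 30, 7, 2), (36, 3, 36, 7, 3),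
    (41, 3, 41, 17, 2), (44, 3, 0, 5, 3), (44, 4, 44, 13, 2), (45, 3, 45, 19, 3),
    (56, 3, 56, 13, 3), (56, 4, 56, 13, 3), (56, 5, 56, 13, 3), (56, 6, 56, 13, 3),
    (56, 7, 56, 17, 4), (57, 3, 57, 7, 3), (57, 4, 0, 5, 3), (57, 5, 57, 13, 2),
    (57, 6, 57, 13, 2), (58, 3, 0, 5, 3), (58, 4, 0, 5, 3), (58, 5, 58, 17, 2), (59, 3, 0, 5, 3),
    (59, 4, 59, 41, 3)]

theorem prime_of_mem_primeList : ∀ p ∈ primeList, p.Prime := by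
  unfold primeList
  simp only [List.forall_mem_cons]
  norm_num

theorem exceptionalList_spec : ∀ q ∈ exceptionalList, ¬ RationalAtRoots q.2.1 q.1 := by
  have key : ∀ q ∈ exceptionalList, Nat.Prime q.2.2.2.1 ∧ (q.2.2.1 = 0 ∨ q.2.2.1 = q.1) ∧
      q.2.2.2.1 ≠ 2 ∧ 2 ≤ q.2.2.2.2 ∧ q.2.2.2.2 ≤ q.2.1 ∧
      q.2.2.2.1 ∣ 2 * q.2.2.1 + 2 * q.2.2.2.2 - 1 ∧
      (∀ i < q.2.1, ¬ q.2.2.2.1 ^ 2 ∣ 2 * q.2.2.1 + 2 * i + 1) ∧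
      (∀ i < q.2.2.2.2 - 1, ¬ q.2.2.2.1 ∣ 2 * q.2.2.1 + 2 * i + 1) ∧
      ¬ q.2.2.2.1 ∣ q.2.1.choose q.2.2.2.2 * (q.2.1 + q.1).ascFactorial q.2.2.2.2 := by
    decide
  intro q hq
  obtain ⟨h1, h2, h3, h4, h5, h6, h7, h8, h9⟩ := key q hq
  exact not_rationalAtRoots_of_squarefree h1 h2 h3 h4 h5 h6 h7 h8 h9

/-- The numerical hypotheses of `lt_of_smooth` with `T = 200`, for `l = k + 3` from `3` to `59`. -/
theorem smooth_bound_check : ∀ k < 57,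
    ((Finset.range (2 * (k + 3) + 3)).filter Nat.Prime).card ≤ 2 * (k + 3) - 1 ∧
    (2 * (k + 3) - 1).factorial * (200 + (2 * (k + 3) - 1) - 1) ^
      ((Finset.range (2 * (k + 3) + 3)).filter Nat.Prime).card < 200 ^ (2 * (k + 3) - 1) := by
  decide +kernel

/-- For `3 ≤ l ≤ 59` and `3 ≤ n < 100`, outside the exceptional parameters, some prime
`p ≥ 2 * l + 3` has a multiple among `2 * n + 1, ..., 2 * n + 2 * l - 1`. -/
theorem small_parameters_check : ∀ l' < 57, ∀ n' < 97,
    (primeList.any fun p => Nat.ble (2 * (l' + 3) + 3) p &&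
      Nat.ble (2 * (n' + 3) + 1) ((2 * (n' + 3) + 2 * (l' + 3) - 1) / p * p)) = true ∨
    (l' = 8 ∧ n' = 0) ∨
    (exceptionalList.any fun q => q.1 == l' + 3 && q.2.1 == n' + 3) = true := by
  decide +kernel

/-- For all parameters in range, rationality at the roots fails. -/
theorem not_rationalAtRoots {n l : ℕ} (hl : 3 ≤ l) (hl' : l ≤ 59) (hn : 2 ≤ n) :
    ¬ RationalAtRoots n l := by
  rcases eq_or_ne n 2 with rfl | hn2
  · exact not_rationalAtRoots_two (by omega)
  by_cases hsmooth : ∀ i, 1 ≤ i → i ≤ 2 * l - 1 → ∀ p, p.Prime → p ∣ 2 * n + i → p < 2 * l + 3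
  · obtain ⟨k, rfl⟩ : ∃ k, l = k + 3 := ⟨l - 3, by omega⟩
    obtain ⟨h1, h2⟩ := smooth_bound_check k (by omega)
    have hlt := lt_of_smooth (by omega) hsmooth h1 (by norm_num) h2
    obtain ⟨n', rfl⟩ : ∃ n', n = n' + 3 := ⟨n - 3, by omega⟩
    rcases small_parameters_check k (by omega) n' (by omega) with h | ⟨rfl, rfl⟩ | h
    · obtain ⟨p, hp, h3⟩ := List.any_eq_true.1 h
      rw [Bool.and_eq_true, Nat.ble_eq, Nat.ble_eq] at h3
      have hle := Nat.div_mul_le_self (2 * (n' + 3) + 2 * (k + 3) - 1) p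
      have hd : p ∣ (2 * (n' + 3) + 2 * (k + 3) - 1) / p * p := dvd_mul_left _ _
      generalize (2 * (n' + 3) + 2 * (k + 3) - 1) / p * p = M at *
      obtain ⟨i, rfl⟩ : ∃ i, M = 2 * (n' + 3) + i := ⟨M - 2 * (n' + 3), by omega⟩
      exact not_rationalAtRoots_of_prime_dvd (prime_of_mem_primeList p hp) h3.1 (by omega)
        (by omega) hd
    · exact not_rationalAtRoots_three_eleven
    · obtain ⟨q, hq, h3⟩ := List.any_eq_true.1 h
      rw [Bool.and_eq_true, beq_iff_eq, beq_iff_eq] at h3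
      have := exceptionalList_spec q hq
      rwa [h3.1, h3.2] at this
  · push Not at hsmooth
    obtain ⟨i, hi, hil, p, hp, hd, hpl⟩ := hsmooth
    exact not_rationalAtRoots_of_prime_dvd hp hpl hi hil hd

/-- The quadrature weights of a stiff configuration are rational, being proportions of points. -/
theorem rationalAtRoots_of_isStiff {n l : ℕ} (hn : 1 ≤ n) {X : Finset (UnitSphere (2 * l + 2))}
    (hX : IsStiff (2 * n) X) : RationalAtRoots n l := by
  obtain ⟨-, hdes, z, hz⟩ := hX
  obtain ⟨T, w, hT, h1, hw, hQ⟩ := hdes.exists_quadrature (by omega) z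
  have hcard : T.card ≤ 2 * n := by
    have h2 : (innerProducts z X).ncard ≤ 2 * n := hz
    rwa [← hT, Set.ncard_coe_finset] at h2
  intro b hb K _ _ _ y hy
  exact rational_at_roots hn hcard h1 hw hQ hb hy

theorem mainTheorem5 (d : ℕ) (hd : Even d) (hd8 : 8 ≤ d) (hd120 : d ≤ 120)
    (n : ℕ) (hn : 1 ≤ n) :
    (∃ X : Finset (UnitSphere d), IsStiff (2 * n) X) ↔ n = 1 := by
  constructor
  · rintro ⟨X, hX⟩
    by_contra hne
    obtain ⟨l, rfl⟩ : ∃ l, d = 2 * l + 2 := by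
      obtain ⟨k, rfl⟩ := hd
      exact ⟨k - 1, by omega⟩
    exact not_rationalAtRoots (by omega) (by omega) (by omega) (rationalAtRoots_of_isStiff hn hX)
  · rintro rfl
    exact exists_two_stiff (by omega)
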